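/- Let $G$ be a finite group and $p$ a prime dividing $|G|$. For a finite group $H$ let $O_p(H)$ be its largest normal $p$-subgroup; $H$ has characteristic $p$ if $C_H(O_p(H)) \le O_p(H)$. Say that $G$ has parabolic characteristic $p$ if $N_G(Q)$ has characteristic $p$ for every nontrivial $p$-subgroup $Q$ of $G$ such that $N_G(Q)$ contains a Sylow $p$-subgroup of $G$. An element of $G$ is $p$-central if it has order $p$ and lies in the center of some Sylow $p$-subgroup of $G$. For a $p$-subgroup $P \le G$ let $\widehat{P}$ be the subgroup generated by the $p$-central elements of $G$ contained in $\Omega_1 Z(P)$, the subgroup generated by the elements $x \in Z(P)$ with $x^p=1$. Let $\mathcal{S}_p(G)$ (Brown), $\mathcal{A}_p(G)$ (Quillen) and $\mathcal{B}_p(G)$ (Bouc) be the sets of, respectively, all nontrivial $p$-subgroups, all nontrivial elementary abelian $p$-subgroups, and all nontrivial $p$-radical subgroups (those $p$-subgroups $R$ with $R = O_p(N_G(R))$) of $G$. For each such set $\mathcal{C}_p(G)$ let $\widehat{\mathcal{C}}_p(G) = \{P \in \mathcal{C}_p(G) \mid \widehat{P} \neq 1\}$, ordered by inclusion and with $G$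 acting by conjugation, and let $|\widehat{\mathcal{C}}_p(G)|$ be its nerve, the simplicial complex whose simplices are the nonempty chains, with the induced $G$-action. Proposition 3.7. If $G$ has parabolic characteristic $p$, then $\widehat{\mathcal{B}}_p(G)$, $\widehat{\mathcal{A}}_p(G)$ and $\widehat{\mathcal{S}}_p(G)$ are $G$-homotopy equivalent; that is, for any two of them there are $G$-equivariant continuous maps between the geometric realizations of their nerves, in both directions, whose two composites are homotopic to the identity maps through $G$-equivariant homotopies. -/

import Mathlib

open scoped Pointwise

noncomputable section

/-! ### `O_p`, characteristic `p` and parabolic characteristic `p` -/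

/-- `O_p(H)`: the join of all normal `p`-subgroups of `H`. For finite `H` this is the largest
normal `p`-subgroup of `H`. -/
def pCore (p : ℕ) (H : Type*) [Group H] : Subgroup H :=
  sSup {N : Subgroup H | N.Normal ∧ IsPGroup p N}

/-- `O_p(H)` for a subgroup `H` of `G`, viewed as a subgroup of `G`. -/
def pCoreOf {G : Type*} [Group G] (p : ℕ) (H : Subgroup G) : Subgroup G :=
  (pCore p H).map H.subtype

/-- `H` has characteristic `p` if `C_H(O_p(H)) ≤ O_p(H)`. -/
def HasCharacteristic (p : ℕ) (H : Type*) [Group H] : Prop :=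
  Subgroup.centralizer (pCore p H : Set H) ≤ pCore p H

/-- A `p`-local subgroup is the normalizer of a nontrivial `p`-subgroup. -/
def IsPLocal {G : Type*} [Group G] (p : ℕ) (H : Subgroup G) : Prop :=
  ∃ Q : Subgroup G, Q ≠ ⊥ ∧ IsPGroup p Q ∧ H = Subgroup.normalizer (Q : Set G)

/-- A parabolic subgroup is a subgroup which contains a Sylow `p`-subgroup of `G`. -/
def IsParabolic {G : Type*} [Group G] (p : ℕ) (H : Subgroup G) : Prop :=
  ∃ S : Sylow p G, (S : Subgroup G) ≤ H

/-- `G` has parabolic characteristic `p` if all `p`-local, parabolic subgroups of `G` have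
characteristic `p`. -/
def HasParabolicCharacteristic (p : ℕ) (G : Type*) [Group G] : Prop :=
  ∀ H : Subgroup G, IsPLocal p H → IsParabolic p H → HasCharacteristic p H

/-! ### Radical, elementary abelian and distinguished subgroups -/

/-- A `p`-subgroup `R` of `G` is `p`-radical if `R = O_p(N_G(R))`. -/
def IsRadicalPSubgroup {G : Type*} [Group G] (p : ℕ) (R : Subgroup G) : Prop :=
  IsPGroup p R ∧ R = pCoreOf p (Subgroup.normalizer (R : Set G))

/-- `E` is an elementary abelian `p`-subgroup: it is abelian and `x ^ p = 1` for all `x ∈ E`. -/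
def IsElementaryAbelian {G : Type*} [Group G] (p : ℕ) (E : Subgroup G) : Prop :=
  (∀ x ∈ E, ∀ y ∈ E, x * y = y * x) ∧ ∀ x ∈ E, x ^ p = 1

/-- The center `Z(P)` of a subgroup `P` of `G`, viewed as a subgroup of `G`. -/
def centerOf {G : Type*} [Group G] (P : Subgroup G) : Subgroup G :=
  (Subgroup.center P).map P.subtype

/-- `Ω₁(A)`: the subgroup generated by the elements `x ∈ A` with `x ^ p = 1`. -/
def omegaOne {G : Type*} [Group G] (p : ℕ) (A : Subgroup G) : Subgroup G :=
  Subgroup.closure {x : G | x ∈ A ∧ x ^ p = 1}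

/-- `Γ_p(G)`: the set of `p`-central elements of `G`, i.e. the elements of order `p` lying in the
center of some Sylow `p`-subgroup of `G`. -/
def pCentralElements (p : ℕ) (G : Type*) [Group G] : Set G :=
  {x : G | orderOf x = p ∧ ∃ S : Sylow p G, x ∈ centerOf (S : Subgroup G)}

/-- `P̂`: the subgroup generated by the `p`-central elements of `G` lying in `Ω₁(Z(P))`. -/
def distinguishedPart {G : Type*} [Group G] (p : ℕ) (P : Subgroup G) : Subgroup G :=
  Subgroup.closure {x : G | x ∈ omegaOne p (centerOf P) ∧ x ∈ pCentralElements p G}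

/-! ### Invariance of these notions under automorphisms -/

theorem map_pCore {p : ℕ} {H K : Type*} [Group H] [Group K] (e : H ≃* K) :
    (pCore p H).map e.toMonoidHom = pCore p K := by
  apply le_antisymm
  · rw [Subgroup.map_le_iff_le_comap]
    refine sSup_le fun N hN => ?_
    rw [← Subgroup.map_le_iff_le_comap]
    exact le_sSup ⟨hN.1.map _ e.surjective, hN.2.map _⟩
  · refine sSup_le fun N hN => ?_
    intro x hx
    refine ⟨e.symm x, ?_, by simp⟩
    have hN' : N.map e.symm.toMonoidHom ≤ pCore p H :=
      le_sSup ⟨hN.1.map _ e.symm.surjective, hN.2.map _⟩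
    exact hN' ⟨x, hx, rfl⟩

theorem map_pCoreOf {G : Type*} [Group G] {p : ℕ} (e : G ≃* G) (H : Subgroup G) :
    (pCoreOf p H).map e.toMonoidHom = pCoreOf p (H.map e.toMonoidHom) := by
  have h := map_pCore (p := p) (e.subgroupMap H)
  change _ = (pCore p (H.map (e : G →* G))).map (H.map (e : G →* G)).subtype
  unfold pCoreOf
  rw [← h, Subgroup.map_map, Subgroup.map_map]
  rfl

theorem map_centerOf {G : Type*} [Group G] (e : G ≃* G) (P : Subgroup G) :
    (centerOf P).map e.toMonoidHom = centerOf (P.map e.toMonoidHom) := by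
  ext x
  simp only [centerOf, Subgroup.mem_map, Subgroup.mem_center_iff]
  constructor
  · rintro ⟨_, ⟨z, hz, rfl⟩, rfl⟩
    refine ⟨⟨e z, z, z.2, rfl⟩, ?_, rfl⟩
    rintro ⟨_, y, hy, rfl⟩
    have h := congrArg (fun w : P => e w) (hz ⟨y, hy⟩)
    apply Subtype.ext
    change e y * e z = e z * e y
    rw [← map_mul, ← map_mul]
    exact h
  · rintro ⟨⟨_, z, hz, rfl⟩, h, rfl⟩
    refine ⟨z, ⟨⟨z, hz⟩, ?_, rfl⟩, rfl⟩
    intro y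
    have h' := congrArg Subtype.val (h ⟨e y, y, y.2, rfl⟩)
    apply Subtype.ext
    apply e.injective
    change e (y * z) = e (z * y)
    rw [map_mul, map_mul]
    exact h'

theorem map_omegaOne {G : Type*} [Group G] {p : ℕ} (e : G ≃* G) (A : Subgroup G) :
    (omegaOne p A).map e.toMonoidHom = omegaOne p (A.map e.toMonoidHom) := by
  unfold omegaOne
  rw [MonoidHom.map_closure]
  congr 1
  ext x
  constructor
  · rintro ⟨y, ⟨hy, hp⟩, rfl⟩
    refine ⟨⟨y, hy, rfl⟩, ?_⟩
    rw [← map_pow, hp, map_one]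
  · rintro ⟨⟨y, hy, rfl⟩, hp⟩
    rw [← map_pow] at hp
    exact ⟨y, ⟨hy, e.injective (hp.trans (map_one e).symm)⟩, rfl⟩

theorem conj_mem_pCentralElements {G : Type*} [Group G] {p : ℕ} (g : G) {x : G}
    (hx : x ∈ pCentralElements p G) : MulAut.conj g x ∈ pCentralElements p G := by
  obtain ⟨ho, S, hS⟩ := hx
  refine ⟨by rw [← ho]; exact MulEquiv.orderOf_eq (MulAut.conj g) x, g • S, ?_⟩
  have h := map_centerOf (MulAut.conj g) (S : Subgroup G)
  have h2 : ((g • S : Sylow p G) : Subgroup G)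
      = (S : Subgroup G).map (MulAut.conj g).toMonoidHom := rfl
  rw [h2, ← h]
  exact ⟨x, hS, rfl⟩

theorem map_distinguishedPart {G : Type*} [Group G] {p : ℕ} (g : G) (P : Subgroup G) :
    (distinguishedPart p P).map (MulAut.conj g).toMonoidHom =
      distinguishedPart p (P.map (MulAut.conj g).toMonoidHom) := by
  unfold distinguishedPart
  rw [MonoidHom.map_closure, ← map_centerOf, ← map_omegaOne]
  congr 1
  ext x
  constructor
  · rintro ⟨y, ⟨hy, hc⟩, rfl⟩
    exact ⟨⟨y, hy, rfl⟩, conj_mem_pCentralElements g hc⟩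
  · rintro ⟨⟨y, hy, rfl⟩, hc⟩
    refine ⟨y, ⟨hy, ?_⟩, rfl⟩
    have := conj_mem_pCentralElements g⁻¹ hc
    simpa [mul_assoc] using this

/-! ### Collections of `p`-subgroups -/

/-- A collection of `p`-subgroups of `G`: a set of `p`-subgroups closed under conjugation. Here
`MulAut.conj g • P` is the conjugate `g P g⁻¹`. -/
structure PCollection (p : ℕ) (G : Type*) [Group G] where
  carrier : Set (Subgroup G)
  isPGroup : ∀ P ∈ carrier, IsPGroup p P
  conj_mem : ∀ (g : G), ∀ P ∈ carrier, MulAut.conj g • P ∈ carrier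

namespace PCollection

variable {p : ℕ} {G : Type*} [Group G]

/-- The subgroups belonging to a collection, as a type; it is ordered by inclusion. -/
abbrev Elem (C : PCollection p G) : Type _ := {P : Subgroup G // P ∈ C.carrier}

/-- `G` acts on a collection by conjugation. -/
instance (C : PCollection p G) : MulAction G C.Elem where
  smul g P := ⟨MulAut.conj g • P.1, C.conj_mem g P.1 P.2⟩
  one_smul P := Subtype.ext (by
    change MulAut.conj (1 : G) • P.1 = P.1
    rw [map_one, one_smul])
  mul_smul g h P := Subtype.ext (by
    change MulAut.conj (g * h) • P.1 = MulAut.conj g • MulAut.conj h • P.1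
    rw [map_mul, mul_smul])

/-- Conjugation preserves inclusions, so a collection is a `G`-poset. -/
instance (C : PCollection p G) :
    CovariantClass G C.Elem (fun g P => g • P) (fun P Q => P ≤ Q) where
  elim g P Q h := by
    change MulAut.conj g • P.1 ≤ MulAut.conj g • Q.1
    exact Subgroup.map_mono h

instance [Finite G] (C : PCollection p G) : Fintype C.Elem := Fintype.ofFinite _

variable (p G)

/-- The Brown collection `S_p(G)` of nontrivial `p`-subgroups. -/
def brown : PCollection p G where
  carrier := {P | P ≠ ⊥ ∧ IsPGroup p P}
  isPGroup P h := h.2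
  conj_mem g P h := by
    refine ⟨fun h0 => h.1 ?_, h.2.map _⟩
    exact (Subgroup.map_eq_bot_iff_of_injective P (MulAut.conj g).injective).1 h0

/-- The Quillen collection `A_p(G)` of nontrivial elementary abelian `p`-subgroups. -/
def quillen : PCollection p G where
  carrier := {E | E ≠ ⊥ ∧ IsElementaryAbelian p E}
  isPGroup E h x := ⟨1, by ext; simpa using h.2.2 x x.2⟩
  conj_mem g E h := by
    refine ⟨fun h0 => h.1 ?_, ?_, ?_⟩
    · exact (Subgroup.map_eq_bot_iff_of_injective E (MulAut.conj g).injective).1 h0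
    · rintro _ ⟨x, hx, rfl⟩ _ ⟨y, hy, rfl⟩
      change MulAut.conj g x * MulAut.conj g y = MulAut.conj g y * MulAut.conj g x
      rw [← map_mul, ← map_mul, h.2.1 x hx y hy]
    · rintro _ ⟨x, hx, rfl⟩
      change (MulAut.conj g x) ^ p = 1
      rw [← map_pow, h.2.2 x hx, map_one]

/-- The Bouc collection `B_p(G)` of nontrivial `p`-radical subgroups. -/
def bouc : PCollection p G where
  carrier := {R | R ≠ ⊥ ∧ IsRadicalPSubgroup p R}
  isPGroup R h := h.2.1
  conj_mem g R h := by
    refine ⟨fun h0 => h.1 ?_, h.2.1.map _, ?_⟩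
    · exact (Subgroup.map_eq_bot_iff_of_injective R (MulAut.conj g).injective).1 h0
    · change R.map (MulAut.conj g).toMonoidHom =
        pCoreOf p (Subgroup.normalizer ((R.map (MulAut.conj g).toMonoidHom : Subgroup G) : Set G))
      have h1 := Subgroup.map_equiv_normalizer_eq R (MulAut.conj g)
      rw [← h1, ← map_pCoreOf, ← h.2.2]

variable {p G}

/-- The distinguished collection `Ĉ`: the subgroups `P` in the collection `C` with `P̂ ≠ 1`. -/
def distinguished (C : PCollection p G) : PCollection p G where
  carrier := {P | P ∈ C.carrier ∧ distinguishedPart p P ≠ ⊥}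
  isPGroup P h := C.isPGroup P h.1
  conj_mem g P h := by
    refine ⟨C.conj_mem g P h.1, fun h0 => h.2 ?_⟩
    have h1 := map_distinguishedPart (p := p) g P
    exact (Subgroup.map_eq_bot_iff_of_injective _ (MulAut.conj g).injective).1 (h1.trans h0)

end PCollection

/-! ### The nerve of a finite `G`-poset -/

/-- The (geometric realization of the) nerve `|X|` of a finite poset `X`, i.e. of the simplicial
complex whose simplices are the nonempty finite chains of `X`. A point is given by its barycentric
coordinates: a function `f : X → ℝ` with nonnegative values of sum `1`, supported on a chain. The
topology is the subspace topology of `X → ℝ`. -/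
def Nerve (X : Type*) [PartialOrder X] [Fintype X] : Type _ :=
  {f : X → ℝ // f ∈ stdSimplex ℝ X ∧ IsChain (fun x y => x ≤ y) {x : X | f x ≠ 0}}

namespace Nerve

variable {G X : Type*} [Group G] [PartialOrder X] [Fintype X]

instance : TopologicalSpace (Nerve X) :=
  inferInstanceAs (TopologicalSpace
    {f : X → ℝ // f ∈ stdSimplex ℝ X ∧ IsChain (fun x y => x ≤ y) {x : X | f x ≠ 0}})

/-- The simplicial action of `G` on `|X|` for a `G`-poset `X`; the vertex `x` is sent by `g` to
the vertex `g • x`. -/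
instance [MulAction G X] [CovariantClass G X (fun g x => g • x) (fun x y => x ≤ y)] :
    MulAction G (Nerve X) where
  smul g f := ⟨fun x => f.1 (g⁻¹ • x), ⟨⟨fun x => f.2.1.1 _, by
      rw [← f.2.1.2]
      exact Equiv.sum_comp (MulAction.toPerm g⁻¹) f.1⟩, by
      intro x hx y hy hxy
      have mono : ∀ {a b : X}, g⁻¹ • a ≤ g⁻¹ • b → a ≤ b := fun {a b} h => by
        have := CovariantClass.elim (μ := fun (g : G) (x : X) => g • x)
          (r := fun x y => x ≤ y) g h
        simpa using this
      exact (f.2.2 hx hy (fun h => hxy (MulAction.injective g⁻¹ h))).imp mono mono⟩⟩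
  one_smul f := Subtype.ext (funext fun x => by
    change f.1 ((1 : G)⁻¹ • x) = f.1 x
    rw [inv_one, one_smul])
  mul_smul g h f := Subtype.ext (funext fun x => by
    change f.1 ((g * h)⁻¹ • x) = f.1 (h⁻¹ • g⁻¹ • x)
    rw [mul_inv_rev, mul_smul])

end Nerve

/-! ### Equivariant homotopy equivalence -/

/-- Two maps of `G`-spaces are `G`-homotopic if there is a homotopy `H : I × X → Y` between them
with `H (t, g x) = g H (t, x)`. -/
def GHomotopic (G : Type*) {X Y : Type*} [Group G] [TopologicalSpace X] [TopologicalSpace Y]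
    [MulAction G X] [MulAction G Y] (f₀ f₁ : C(X, Y)) : Prop :=
  ∃ H : ContinuousMap.Homotopy f₀ f₁,
    ∀ (g : G) (t : unitInterval) (x : X), H (t, g • x) = g • H (t, x)

/-- Two `G`-spaces are `G`-homotopy equivalent if there are continuous `G`-maps between them, in
both directions, whose composites are `G`-homotopic to the identity maps. -/
def GHomotopyEquivalent (G X Y : Type*) [Group G] [TopologicalSpace X] [TopologicalSpace Y]
    [MulAction G X] [MulAction G Y] : Prop :=
  ∃ (f : C(X, Y)) (f' : C(Y, X)),
    (∀ (g : G) (x : X), f (g • x) = g • f x) ∧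
    (∀ (g : G) (y : Y), f' (g • y) = g • f' y) ∧
    GHomotopic G (f'.comp f) (ContinuousMap.id X) ∧
    GHomotopic G (f.comp f') (ContinuousMap.id Y)

/-- Two collections of `p`-subgroups of the finite group `G` are `G`-homotopy equivalent if their
nerves are. -/
def PCollection.GHomotopyEquiv {p : ℕ} {G : Type*} [Group G] [Finite G]
    (C D : PCollection p G) : Prop :=
  GHomotopyEquivalent G (Nerve C.Elem) (Nerve D.Elem)

end

/-! Both the Bouc and the Quillen collections are compared with the distinguished Brown poset, from
which the unwanted subgroups are deleted one order at a time, smallest first (`orLarge`). Subgroups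
of equal order form an antichain, so a chain meets at most one deleted subgroup `P`. A deletion
preserves the `G`-homotopy type when the members above `P`, or those below it, are contracted by a
zigzag of order-preserving maps compatible with conjugation.

Quillen: for `P` not elementary abelian, use `Q ≤ Q P̂ ≥ P̂` on the members `Q < P`. These are
already elementary abelian, and `P̂` is central in `P`.

Bouc: for `P` not radical, `R = O_p(N_G(P))` is larger than `P`; use `Q ≥ N_Q(P) ≤ R N_Q(P) ≥ R` on
the members `Q > P`. All terms must be distinguished. For `N_Q(P)` a `p`-central element of `Z(Q)`
serves. For `p`-subgroups containing `R` one needs `N_G(P)` to have characteristic `p`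
(`distinguishedPart_ne_bot_of_pCoreOf_le`): then a `p`-central element of a Sylow subgroup above
them centralizes `R` and so lies in `R`.

That `N_G(P)` has characteristic `p` (`HasParabolicCharacteristic.hasCharacteristic_normalizer`) is
deduced from the parabolic subgroup `L = N_G(⟨x⟩)`, where `x` is a `p`-central element of `Z(P)`, by
Thompson's `A × B` lemma for the action of `P` and a `p'`-element on `O_p(L)`.

The deletion principle is `Nerve.gHomotopyEquivalent_of_isUpperContraction`. Its proof writes down
one continuous formula in barycentric coordinates, `pushOff`, which drains the weight of `P` while
transporting the weight above `P` along the zigzag. -/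

open scoped Pointwise

noncomputable section

namespace Nerve

/-! ### Pushing weight off an antichain of a finite poset. -/

section Removal

variable {X : Type*} [PartialOrder X] [Fintype X]

open Classical in
/-- The total weight of `w` strictly above `x`. -/
def massAbove (x : X) (w : X → ℝ) : ℝ := ∑ y with x < y, w y

open Classical in
/-- The weight of `w` on the interval `(x, q]`. -/
def massUpTo (x : X) (w : X → ℝ) (q : X) : ℝ := ∑ y with x < y ∧ y ≤ q, w y

open Classical in
/-- The weight of `w` on the interval `(x, q)`. -/
def massBefore (x : X) (w : X → ℝ) (q : X) : ℝ := ∑ y with x < y ∧ y < q, w y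

/-- The part of the weight `w q` lying within the lowest portion of size `a` of the weight
above `x`. -/
def lowerPart (x : X) (w : X → ℝ) (a : ℝ) (q : X) : ℝ :=
  min (massUpTo x w q) a - min (massBefore x w q) a

open Classical in
/-- The weight `w` above `x`, moved for a time `s` along the zigzag `q ≥ n x q ≤ m x q ≥ r x`,
with additional weight at `r x` after the end of the movement. -/
def moved (n m : X → X → X) (r : X → X) (x : X) (w : X → ℝ) (s : ℝ) (z : X) : ℝ :=
  -- With `μ = massAbove x w`, the three legs occupy the times `[0, μ]`, `[μ, 2μ]` and `[2μ, 3μ]`.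
  -- The two descending legs take the lowest weight first, the ascending leg the highest first; the
  -- four terms are the weights currently at `q`, `n x q`, `m x q` and `r x`.
  (∑ q with x < q,
    ((w q - lowerPart x w s q) * (Pi.single q 1 : X → ℝ) z
    + lowerPart x w (min s (2 * massAbove x w - s)) q * (Pi.single (n x q) 1 : X → ℝ) z
    + (w q - lowerPart x w |2 * massAbove x w - s| q) * (Pi.single (m x q) 1 : X → ℝ) z
    + lowerPart x w (s - 2 * massAbove x w) q * (Pi.single (r x) 1 : X → ℝ) z))
  + max 0 (s - 3 * massAbove x w) * (Pi.single (r x) 1 : X → ℝ) z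

open Classical in
/-- The deformation pushing the weight off the elements of `D`, before normalization. -/
def pushOff (D : Set X) (n m : X → X → X) (r : X → X) (t : ℝ) (w : X → ℝ) (z : X) : ℝ :=
  w z - (if z ∈ D then t * w z else 0) +
    -- The travel time `t * w x` vanishes with `w x`, so the formula stays continuous when `x`
    -- leaves the support.
    ∑ x with x ∈ D, (moved n m r x w (t * w x) z - if x < z then w z else 0)

/-- `D` is an antichain and for each `x ∈ D` the zigzag `q ≥ n x q ≤ m x q ≥ r x` contracts
the elements above `x`. -/
structure IsUpperContraction (D : Set X) (n m : X → X → X) (r : X → X) : Prop where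
  antichain : ∀ x ∈ D, ∀ y ∈ D, x ≤ y → x = y
  n_mono : ∀ x ∈ D, ∀ q q', x < q → q ≤ q' → n x q ≤ n x q'
  m_mono : ∀ x ∈ D, ∀ q q', x < q → q ≤ q' → m x q ≤ m x q'
  lt_n : ∀ x ∈ D, ∀ q, x < q → x < n x q
  n_le : ∀ x ∈ D, ∀ q, x < q → n x q ≤ q
  n_le_m : ∀ x ∈ D, ∀ q, x < q → n x q ≤ m x q
  lt_r : ∀ x ∈ D, x < r x
  r_le_m : ∀ x ∈ D, ∀ q, x < q → r x ≤ m x q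

theorem massUpTo_eq {x q : X} (w : X → ℝ) (h : x < q) :
    massUpTo x w q = massBefore x w q + w q := by
  classical
  unfold massUpTo massBefore
  rw [add_comm, ← Finset.sum_insert (by simp)]
  refine Finset.sum_congr ?_ fun _ _ => rfl
  ext y
  simp only [Finset.mem_filter, Finset.mem_univ, true_and, Finset.mem_insert]
  constructor
  · rintro ⟨h1, h2⟩
    rcases eq_or_lt_of_le h2 with h3 | h3
    · exact Or.inl h3
    · exact Or.inr ⟨h1, h3⟩
  · rintro (rfl | ⟨h1, h2⟩)
    · exact ⟨h, le_rfl⟩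
    · exact ⟨h1, h2.le⟩

variable {w : X → ℝ}

theorem massBefore_nonneg (hw : ∀ y, 0 ≤ w y) (x q : X) : 0 ≤ massBefore x w q :=
  Finset.sum_nonneg fun y _ => hw y

theorem massAbove_nonneg (hw : ∀ y, 0 ≤ w y) (x : X) : 0 ≤ massAbove x w :=
  Finset.sum_nonneg fun y _ => hw y

theorem massUpTo_le_massAbove (hw : ∀ y, 0 ≤ w y) (x q : X) :
    massUpTo x w q ≤ massAbove x w := by
  classical
  refine Finset.sum_le_sum_of_subset_of_nonneg (fun y => ?_) fun y _ _ => hw y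
  simp only [Finset.mem_filter, Finset.mem_univ, true_and]
  exact fun h => h.1

theorem massUpTo_le_massBefore (hw : ∀ y, 0 ≤ w y) (x : X) {q q' : X} (h : q < q') :
    massUpTo x w q ≤ massBefore x w q' := by
  classical
  refine Finset.sum_le_sum_of_subset_of_nonneg (fun y => ?_) fun y _ _ => hw y
  simp only [Finset.mem_filter, Finset.mem_univ, true_and]
  exact fun h' => ⟨h'.1, h'.2.trans_lt h⟩

theorem lowerPart_nonneg (hw : ∀ y, 0 ≤ w y) {x q : X} (h : x < q) (a : ℝ) :
    0 ≤ lowerPart x w a q := by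
  have := hw q
  rw [lowerPart, massUpTo_eq w h, sub_nonneg]
  exact min_le_min_right _ (by linarith)

theorem lowerPart_le (hw : ∀ y, 0 ≤ w y) {x q : X} (h : x < q) (a : ℝ) :
    lowerPart x w a q ≤ w q := by
  have := hw q
  rw [lowerPart, massUpTo_eq w h, sub_le_iff_le_add]
  rcases le_total (massBefore x w q) a with h1 | h1
  · rw [min_eq_left h1]; exact (min_le_left _ _).trans (by linarith)
  · rw [min_eq_right h1]; exact (min_le_right _ _).trans (by linarith)

theorem lowerPart_eq_zero (hw : ∀ y, 0 ≤ w y) {x q : X} (h : x < q) {a : ℝ}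
    (ha : a ≤ massBefore x w q) : lowerPart x w a q = 0 := by
  have := hw q
  rw [lowerPart, massUpTo_eq w h, min_eq_right ha, min_eq_right (by linarith), sub_self]

theorem lowerPart_eq_self (hw : ∀ y, 0 ≤ w y) {x q : X} (h : x < q) {a : ℝ}
    (ha : massUpTo x w q ≤ a) : lowerPart x w a q = w q := by
  have := hw q
  have h1 := massUpTo_eq w h
  rw [lowerPart, min_eq_left ha, min_eq_left (by linarith)]
  linarith

theorem moved_zero (n m : X → X → X) (r : X → X) (hw : ∀ y, 0 ≤ w y) (x z : X)
    [Decidable (x < z)] : moved n m r x w 0 z = if x < z then w z else 0 := by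
  classical
  have hμ := massAbove_nonneg hw x
  have h1 : ∀ q ∈ Finset.univ.filter (x < ·),
      ((w q - lowerPart x w 0 q) * (Pi.single q 1 : X → ℝ) z
      + lowerPart x w (min 0 (2 * massAbove x w - 0)) q * (Pi.single (n x q) 1 : X → ℝ) z
      + (w q - lowerPart x w |2 * massAbove x w - 0| q) * (Pi.single (m x q) 1 : X → ℝ) z
      + lowerPart x w (0 - 2 * massAbove x w) q * (Pi.single (r x) 1 : X → ℝ) z)
      = if z = q then w q else 0 := by
    intro q hq
    have hq : x < q := by simpa using hq
    have hb := massBefore_nonneg hw x q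
    have hu := massUpTo_le_massAbove hw x q
    rw [lowerPart_eq_zero hw hq hb, lowerPart_eq_zero hw hq ((min_le_left _ _).trans hb),
      lowerPart_eq_self hw hq (a := |_|) (by rw [abs_of_nonneg (by linarith)]; linarith),
      lowerPart_eq_zero hw hq (by linarith), Pi.single_apply]
    simp
  rw [moved, Finset.sum_congr rfl h1, max_eq_left (by linarith), Finset.sum_ite_eq]
  simp

theorem moved_nonneg (n m : X → X → X) (r : X → X) (hw : ∀ y, 0 ≤ w y) (x : X) (s : ℝ) (z : X) :
    0 ≤ moved n m r x w s z := by
  classical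
  have hs : ∀ y : X, 0 ≤ (Pi.single y 1 : X → ℝ) z := fun y => by
    rw [Pi.single_apply]; split_ifs <;> norm_num
  refine add_nonneg (Finset.sum_nonneg fun q hq => ?_) (mul_nonneg (le_max_left _ _) (hs _))
  have hq : x < q := by simpa using hq
  have h1 := fun a => lowerPart_nonneg hw hq a
  have h2 := fun a => sub_nonneg.2 (lowerPart_le hw hq a)
  exact add_nonneg (add_nonneg (add_nonneg (mul_nonneg (h2 _) (hs _)) (mul_nonneg (h1 _) (hs _)))
    (mul_nonneg (h2 _) (hs _))) (mul_nonneg (h1 _) (hs _))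

/-- Transport conserves mass; only the weight injected at `r x` after time `3μ` is new. -/
theorem sum_moved (n m : X → X → X) (r : X → X) (hw : ∀ y, 0 ≤ w y) (x : X) (s : ℝ) :
    ∑ z, moved n m r x w s z = massAbove x w + max 0 (s - 3 * massAbove x w) := by
  classical
  have hμ := massAbove_nonneg hw x
  simp only [moved]
  rw [Finset.sum_add_distrib, Finset.sum_comm, ← Finset.mul_sum]
  congr 1
  · unfold massAbove
    refine Finset.sum_congr rfl fun q hq => ?_
    have hq : x < q := by simpa using hq
    have hb := massBefore_nonneg hw x q
    have hu := massUpTo_le_massAbove hw x q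
    change _ = w q
    simp only [Finset.sum_add_distrib, ← Finset.mul_sum, Finset.sum_pi_single', Finset.mem_univ,
      if_true, mul_one]
    change (w q - lowerPart x w s q) + lowerPart x w (min s (2 * massAbove x w - s)) q
      + (w q - lowerPart x w |2 * massAbove x w - s| q)
      + lowerPart x w (s - 2 * massAbove x w) q = w q
    -- On each leg at most two of the four terms survive, and these add up to `w q`.
    generalize massAbove x w = μ at *
    rcases le_total s μ with h | h
    · rw [min_eq_left (by linarith), abs_of_nonneg (by linarith),
        lowerPart_eq_self hw hq (a := 2 * μ - s) (by linarith),
        lowerPart_eq_zero hw hq (a := s - 2 * μ) (by linarith)]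
      ring
    · rw [min_eq_right (by linarith), lowerPart_eq_self hw hq (a := s) (by linarith)]
      rcases le_total s (2 * μ) with h' | h'
      · rw [abs_of_nonneg (by linarith), lowerPart_eq_zero hw hq (a := s - 2 * μ) (by linarith)]
        ring
      · rw [abs_of_nonpos (by linarith), lowerPart_eq_zero hw hq (a := 2 * μ - s) (by linarith),
          neg_sub]
        ring
  · simp

/-- The possible elements of the support of the moved weight. -/
theorem moved_support {n m : X → X → X} {r : X → X} (hw : ∀ y, 0 ≤ w y) {x : X} {s : ℝ} {z : X}
    (hz : moved n m r x w s z ≠ 0) :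
    (x < z ∧ w z ≠ 0 ∧ s < massUpTo x w z) ∨
    (∃ q, x < q ∧ w q ≠ 0 ∧ massBefore x w q < s ∧ massBefore x w q < 2 * massAbove x w - s ∧
      z = n x q) ∨
    (∃ q, x < q ∧ w q ≠ 0 ∧ |2 * massAbove x w - s| < massUpTo x w q ∧ z = m x q) ∨
    (2 * massAbove x w < s ∧ z = r x) := by
  classical
  have hμ := massAbove_nonneg hw x
  by_contra! hcon
  obtain ⟨c1, c2, c3, c4⟩ := hcon
  refine hz ?_
  have hr : ∀ q, x < q → lowerPart x w (s - 2 * massAbove x w) q * (Pi.single (r x) 1 : X → ℝ) z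
      = 0 := by
    intro q hq
    rw [Pi.single_apply]
    split_ifs with h
    · rw [lowerPart_eq_zero hw hq, zero_mul]
      have := massBefore_nonneg hw x q
      by_contra! h2
      exact c4 (by linarith) h
    · simp
  unfold moved
  rw [Finset.sum_eq_zero, zero_add, Pi.single_apply]
  · split_ifs with h
    · rw [max_eq_left, zero_mul]
      by_contra! h2
      exact c4 (by linarith) h
    · simp
  · intro q hq
    have hq : x < q := by simpa using hq
    rw [hr q hq, add_zero]
    by_cases hq0 : w q = 0
    · have : ∀ a, lowerPart x w a q = 0 := fun a =>
        le_antisymm ((lowerPart_le hw hq a).trans hq0.le) (lowerPart_nonneg hw hq a)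
      simp [this, hq0]
    simp only [Pi.single_apply]
    have e1 : (w q - lowerPart x w s q) * (if z = q then 1 else 0) = 0 := by
      split_ifs with h
      · subst h
        rw [lowerPart_eq_self hw hq (c1 hq hq0)]; simp
      · simp
    have e2 : lowerPart x w (min s (2 * massAbove x w - s)) q * (if z = n x q then 1 else 0)
        = 0 := by
      split_ifs with h
      · rw [lowerPart_eq_zero hw hq, zero_mul]
        by_contra! h2
        exact c2 q hq hq0 (h2.trans_le (min_le_left _ _)) (h2.trans_le (min_le_right _ _)) h
      · simp
    have e3 : (w q - lowerPart x w |2 * massAbove x w - s| q) * (if z = m x q then 1 else 0)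
        = 0 := by
      split_ifs with h
      · rw [lowerPart_eq_self hw hq, sub_self, zero_mul]
        by_contra! h2
        exact c3 q hq hq0 h2 h
      · simp
    rw [e1, e2, e3]; simp

variable {D : Set X} {n m : X → X → X} {r : X → X}

theorem IsUpperContraction.lt_of_moved_ne_zero (hD : IsUpperContraction D n m r)
    (hw : ∀ y, 0 ≤ w y) {x : X} (hx : x ∈ D) {s : ℝ} {z : X} (hz : moved n m r x w s z ≠ 0) :
    x < z := by
  rcases moved_support hw hz with h | ⟨q, hq, -, -, -, rfl⟩ | ⟨q, hq, -, -, rfl⟩ | ⟨-, rfl⟩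
  · exact h.1
  · exact hD.lt_n x hx q hq
  · exact (hD.lt_r x hx).trans_le (hD.r_le_m x hx q hq)
  · exact hD.lt_r x hx

/-- The order of travel is what keeps the support a chain. While descending from `q` to `n x q`,
weight already moved started at or below the weight still waiting, so `n x q' ≤ q' ≤ q`. While
ascending, weight already moved started at or above the rest, so `n x q ≤ n x q' ≤ m x q'`. On the
last leg `r x` lies below every `m x q`. -/
theorem IsUpperContraction.comparable_of_moved_ne_zero (hD : IsUpperContraction D n m r)
    (hw : ∀ y, 0 ≤ w y) (hc : IsChain (fun x y => x ≤ y) {x : X | w x ≠ 0}) {x : X} (hx : x ∈ D)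
    {s : ℝ} {z z' : X} (hz : moved n m r x w s z ≠ 0) (hz' : moved n m r x w s z' ≠ 0) :
    z ≤ z' ∨ z' ≤ z := by
  have hμ := massAbove_nonneg hw x
  have hu := massUpTo_le_massAbove hw x
  have hb := massBefore_nonneg hw x
  have comp : ∀ a b, w a ≠ 0 → w b ≠ 0 → a ≤ b ∨ b ≤ a := fun a b ha hb => hc.total ha hb
  have key : ∀ a b, w a ≠ 0 → w b ≠ 0 → massBefore x w b < massUpTo x w a → b ≤ a := by
    intro a b ha hb hlt
    by_contra h
    have h2 : a ≤ b := (comp a b ha hb).resolve_right h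
    have h3 : a < b := lt_of_le_not_ge h2 h
    exact absurd (massUpTo_le_massBefore hw x h3) (not_le.2 hlt)
  rcases moved_support hw hz with ⟨a1, a2, a3⟩ | ⟨q, a1, a2, a3, a4, rfl⟩ | ⟨q, a1, a2, a3, rfl⟩ |
      ⟨a1, rfl⟩ <;>
    rcases moved_support hw hz' with ⟨b1, b2, b3⟩ | ⟨q', b1, b2, b3, b4, rfl⟩ |
      ⟨q', b1, b2, b3, rfl⟩ | ⟨b1, rfl⟩
  · exact comp _ _ a2 b2
  · exact Or.inr ((hD.n_le x hx q' b1).trans (key _ _ a2 b2 (b3.trans a3)))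
  -- Weight still at its start forces `s < μ`, weight at `m` forces `s > μ`: distinct legs never
  -- overlap.
  · have := le_abs_self (2 * massAbove x w - s)
    linarith [hu z, hu q']
  · linarith [hu z]
  · exact Or.inl ((hD.n_le x hx q a1).trans (key _ _ b2 a2 (a3.trans b3)))
  · rcases comp _ _ a2 b2 with h | h
    · exact Or.inl (hD.n_mono x hx _ _ a1 h)
    · exact Or.inr (hD.n_mono x hx _ _ b1 h)
  · have := le_abs_self (2 * massAbove x w - s)
    have h := key q' q b2 a2 (by linarith)
    exact Or.inl ((hD.n_mono x hx _ _ a1 h).trans (hD.n_le_m x hx _ b1))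
  · linarith [hb q]
  · have := le_abs_self (2 * massAbove x w - s)
    linarith [hu z', hu q]
  · have := le_abs_self (2 * massAbove x w - s)
    have h := key q q' a2 b2 (by linarith)
    exact Or.inr ((hD.n_mono x hx _ _ b1 h).trans (hD.n_le_m x hx _ a1))
  · rcases comp _ _ a2 b2 with h | h
    · exact Or.inl (hD.m_mono x hx _ _ a1 h)
    · exact Or.inr (hD.m_mono x hx _ _ b1 h)
  · exact Or.inr (hD.r_le_m x hx _ a1)
  · linarith [hu z']
  · linarith [hb q']
  · exact Or.inl (hD.r_le_m x hx _ b1)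
  · exact Or.inl le_rfl

/-! ### Properties of the deformation -/

/-- Makes the deformation stationary on the smaller nerve, so that the retraction is a strict left
inverse of the inclusion. -/
theorem pushOff_of_eq_zero (hw : ∀ y, 0 ≤ w y) (t : ℝ) (h0 : ∀ x ∈ D, w x = 0) :
    pushOff D n m r t w = w := by
  classical
  funext z
  unfold pushOff
  rw [Finset.sum_eq_zero]
  · split_ifs with h
    · rw [h0 z h]; ring
    · ring
  · intro x hx
    rw [h0 x (by simpa using hx), mul_zero, moved_zero n m r hw, sub_self]

theorem pushOff_zero (hw : ∀ y, 0 ≤ w y) : pushOff D n m r 0 w = w := by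
  classical
  funext z
  unfold pushOff
  rw [Finset.sum_eq_zero]
  · simp
  · intro x hx
    rw [zero_mul, moved_zero n m r hw, sub_self]

-- A chain meets the antichain `D` in at most one point, so only one summand of `pushOff` acts.
open Classical in
theorem pushOff_of_ne_zero (hD : IsUpperContraction D n m r) (hw : ∀ y, 0 ≤ w y)
    (hc : IsChain (fun x y => x ≤ y) {x : X | w x ≠ 0}) (t : ℝ) {x : X} (hx : x ∈ D)
    (hwx : w x ≠ 0) (z : X) :
    pushOff D n m r t w z = w z - (if z = x then t * w x else 0) +
      (moved n m r x w (t * w x) z - if x < z then w z else 0) := by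
  have h0 : ∀ y ∈ D, y ≠ x → w y = 0 := by
    intro y hy hne
    by_contra h
    rcases hc.total hwx h with h1 | h1
    · exact hne (hD.antichain x hx y hy h1).symm
    · exact hne (hD.antichain y hy x hx h1)
  unfold pushOff
  rw [Finset.sum_eq_single x]
  · congr 2
    by_cases hzx : z = x
    · subst hzx; simp [hx]
    · rw [if_neg hzx]
      split_ifs with h
      · rw [h0 z h hzx, mul_zero]
      · rfl
  · intro y hy hne
    rw [h0 y (by simpa using hy) hne, mul_zero, moved_zero n m r hw, sub_self]
  · intro h
    simp [hx] at h

/-- The chain splits at `x`: weight below stays, weight at `x` shrinks, and everything above comes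
from the transport. -/
theorem pushOff_support (hD : IsUpperContraction D n m r) (hw : ∀ y, 0 ≤ w y)
    (hc : IsChain (fun x y => x ≤ y) {x : X | w x ≠ 0}) (t : ℝ) {x : X} (hx : x ∈ D)
    (hwx : w x ≠ 0) (z : X) :
    (z < x ∧ pushOff D n m r t w z = w z) ∨
    (z = x ∧ pushOff D n m r t w z = (1 - t) * w x) ∨
    pushOff D n m r t w z = moved n m r x w (t * w x) z := by
  classical
  rw [pushOff_of_ne_zero hD hw hc t hx hwx z]
  have hm : ¬ x < z → moved n m r x w (t * w x) z = 0 := fun h => by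
    by_contra h1
    exact h (hD.lt_of_moved_ne_zero hw hx h1)
  by_cases hzx : z = x
  · subst hzx
    right; left
    refine ⟨rfl, ?_⟩
    rw [hm (lt_irrefl _)]
    simp; ring
  by_cases hxz : x < z
  · right; right
    simp [hzx, hxz]
  · by_cases hwz : w z = 0
    · right; right
      simp [hzx, hwz]
    · left
      have h1 : z ≤ x := by
        rcases hc.total hwx hwz with h1 | h1
        · exact absurd (lt_of_le_of_ne h1 (Ne.symm hzx)) hxz
        · exact h1
      refine ⟨lt_of_le_of_ne h1 hzx, ?_⟩
      rw [hm hxz]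
      simp [hzx, hxz]

theorem pushOff_nonneg (hD : IsUpperContraction D n m r) (hw : ∀ y, 0 ≤ w y)
    (hc : IsChain (fun x y => x ≤ y) {x : X | w x ≠ 0}) {t : ℝ} (ht1 : t ≤ 1)
    (z : X) : 0 ≤ pushOff D n m r t w z := by
  by_cases h : ∃ x ∈ D, w x ≠ 0
  · obtain ⟨x, hx, hwx⟩ := h
    rcases pushOff_support hD hw hc t hx hwx z with ⟨-, h⟩ | ⟨-, h⟩ | h <;> rw [h]
    · exact hw z
    · exact mul_nonneg (by linarith) (hw x)
    · exact moved_nonneg n m r hw _ _ _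
  · push Not at h
    rw [pushOff_of_eq_zero hw t h]
    exact hw z

theorem pushOff_chain (hD : IsUpperContraction D n m r) (hw : ∀ y, 0 ≤ w y)
    (hc : IsChain (fun x y => x ≤ y) {x : X | w x ≠ 0}) (t : ℝ) :
    IsChain (fun x y => x ≤ y) {x : X | pushOff D n m r t w x ≠ 0} := by
  by_cases h : ∃ x ∈ D, w x ≠ 0
  · obtain ⟨x, hx, hwx⟩ := h
    intro z hz z' hz' _
    simp only [Set.mem_ofPred_eq] at hz hz'
    have key := pushOff_support hD hw hc t hx hwx
    have lt := fun z => hD.lt_of_moved_ne_zero hw hx (s := t * w x) (z := z)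
    rcases key z with ⟨a, h⟩ | ⟨a, h⟩ | h <;> rcases key z' with ⟨a', h'⟩ | ⟨a', h'⟩ | h' <;>
      rw [h] at hz <;> rw [h'] at hz'
    · exact hc.total hz hz'
    · subst a'; exact Or.inl a.le
    · exact Or.inl (a.trans (lt _ hz')).le
    · subst a; exact Or.inr a'.le
    · subst a; subst a'; exact Or.inl le_rfl
    · subst a; exact Or.inl (lt _ hz').le
    · exact Or.inr (a'.trans (lt _ hz)).le
    · subst a'; exact Or.inr (lt _ hz).le
    · exact hD.comparable_of_moved_ne_zero hw hc hx hz hz'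
  · push Not at h
    rw [pushOff_of_eq_zero hw t h]
    exact hc

theorem pushOff_one_eq_zero (hD : IsUpperContraction D n m r) (hw : ∀ y, 0 ≤ w y)
    (hc : IsChain (fun x y => x ≤ y) {x : X | w x ≠ 0}) {z : X} (hz : z ∈ D) :
    pushOff D n m r 1 w z = 0 := by
  by_cases h : ∃ x ∈ D, w x ≠ 0
  · obtain ⟨x, hx, hwx⟩ := h
    rcases pushOff_support hD hw hc 1 hx hwx z with ⟨a, -⟩ | ⟨-, h⟩ | h
    · exact absurd (hD.antichain z hz x hx a.le) a.ne
    · rw [h]; ring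
    · rw [h]
      by_contra h1
      have a := hD.lt_of_moved_ne_zero hw hx h1
      exact absurd (hD.antichain x hx z hz a.le) a.ne
  · push Not at h
    rw [pushOff_of_eq_zero hw 1 h]
    exact h z hz

/-- Total mass is not preserved, so the deformation has to be normalized; this permits the division.
-/
theorem sum_pushOff_pos (hD : IsUpperContraction D n m r) (hw : ∀ y, 0 ≤ w y)
    (hc : IsChain (fun x y => x ≤ y) {x : X | w x ≠ 0}) (h1 : ∑ x, w x = 1) {t : ℝ}
    (ht1 : t ≤ 1) : 0 < ∑ z, pushOff D n m r t w z := by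
  classical
  by_cases h : ∃ x ∈ D, w x ≠ 0
  · obtain ⟨x, hx, hwx⟩ := h
    have hs' : t * w x ≤ w x := mul_le_of_le_one_left (hw x) ht1
    have hμ : w x + massAbove x w ≤ 1 := by
      rw [← h1, massAbove, ← Finset.sum_insert (by simp)]
      exact Finset.sum_le_sum_of_subset_of_nonneg (Finset.subset_univ _) fun y _ _ => hw y
    rw [Finset.sum_congr rfl fun z _ => pushOff_of_ne_zero hD hw hc t hx hwx z,
      Finset.sum_add_distrib, Finset.sum_sub_distrib, Finset.sum_sub_distrib,
      sum_moved n m r hw x, h1, Finset.sum_ite_eq', if_pos (Finset.mem_univ _),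
      ← Finset.sum_filter]
    have hμ0 := massAbove_nonneg hw x
    have hx0 : 0 < w x := lt_of_le_of_ne (hw x) (Ne.symm hwx)
    have e1 := le_max_left 0 (t * w x - 3 * massAbove x w)
    have e2 := le_max_right 0 (t * w x - 3 * massAbove x w)
    change 0 < 1 - t * w x + (massAbove x w + max 0 (t * w x - 3 * massAbove x w) - massAbove x w)
    -- If `t * w x` reaches `1`, all weight was at `x` and `massAbove x w` is zero; the weight
    -- injected at `r x` then keeps the total positive.
    by_cases hlt : t * w x < 1
    · linarith
    · linarith
  · push Not at h
    rw [pushOff_of_eq_zero hw t h, h1]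
    exact one_pos

/-- The formula is built from sums, products, minima, maxima and absolute values on all of `ℝ × (X →
ℝ)`, so no gluing over simplices is needed. -/
theorem continuous_pushOff (D : Set X) (n m : X → X → X) (r : X → X) (z : X) :
    Continuous fun p : ℝ × (X → ℝ) => pushOff D n m r p.1 p.2 z := by
  classical
  have hA : ∀ x, Continuous fun p : ℝ × (X → ℝ) => massAbove x p.2 := fun x => by
    unfold massAbove; fun_prop
  have hU : ∀ x q, Continuous fun p : ℝ × (X → ℝ) => massUpTo x p.2 q := fun x q => by
    unfold massUpTo; fun_prop
  have hB : ∀ x q, Continuous fun p : ℝ × (X → ℝ) => massBefore x p.2 q := fun x q => by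
    unfold massBefore; fun_prop
  have hl : ∀ x q (f : ℝ × (X → ℝ) → ℝ), Continuous f →
      Continuous fun p : ℝ × (X → ℝ) => lowerPart x p.2 (f p) q := fun x q f hf =>
    ((hU x q).min hf).sub ((hB x q).min hf)
  have hm : ∀ x, Continuous fun p : ℝ × (X → ℝ) => moved n m r x p.2 (p.1 * p.2 x) z := by
    intro x
    have hf : Continuous fun p : ℝ × (X → ℝ) => p.1 * p.2 x := by fun_prop
    have ha := hA x
    refine (continuous_finsetSum _ fun q _ => ?_).add ?_
    · have l1 := hl x q _ hf
      have l2 := hl x q (fun p => min (p.1 * p.2 x) (2 * massAbove x p.2 - p.1 * p.2 x))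
        (by fun_prop)
      have l3 := hl x q (fun p => |2 * massAbove x p.2 - p.1 * p.2 x|) (by fun_prop)
      have l4 := hl x q (fun p => p.1 * p.2 x - 2 * massAbove x p.2) (by fun_prop)
      fun_prop
    · fun_prop
  have hz : Continuous fun p : ℝ × (X → ℝ) => p.2 z := by fun_prop
  unfold pushOff
  refine (hz.sub ?_).add (continuous_finsetSum _ fun x _ => (hm x).sub ?_)
  · split_ifs <;> fun_prop
  · split_ifs <;> fun_prop

end Removal

end Nerve

/-! ### Equivariant homotopy equivalence is an equivalence relation -/

section GHomotopy

variable {G X Y Z : Type*} [Group G] [TopologicalSpace X] [TopologicalSpace Y]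
  [TopologicalSpace Z] [MulAction G X] [MulAction G Y] [MulAction G Z]

theorem GHomotopic.refl (f : C(X, Y)) (hf : ∀ (g : G) (x : X), f (g • x) = g • f x) :
    GHomotopic G f f :=
  ⟨ContinuousMap.Homotopy.refl f, fun g _ x => hf g x⟩

theorem GHomotopic.symm {f₀ f₁ : C(X, Y)} (h : GHomotopic G f₀ f₁) : GHomotopic G f₁ f₀ := by
  obtain ⟨H, hH⟩ := h
  exact ⟨H.symm, fun g t x => hH g (unitInterval.symm t) x⟩

theorem GHomotopic.trans {f₀ f₁ f₂ : C(X, Y)} (h : GHomotopic G f₀ f₁)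
    (h' : GHomotopic G f₁ f₂) : GHomotopic G f₀ f₂ := by
  obtain ⟨H, hH⟩ := h
  obtain ⟨H', hH'⟩ := h'
  refine ⟨H.trans H', fun g t x => ?_⟩
  rw [ContinuousMap.Homotopy.trans_apply, ContinuousMap.Homotopy.trans_apply]
  split_ifs
  · exact hH g _ x
  · exact hH' g _ x

/-- Removes the inner round trip when two equivalences are composed. -/
theorem GHomotopic.conj {f : C(Y, Y)} (h : GHomotopic G f (ContinuousMap.id Y)) (a : C(X, Y))
    (b : C(Y, X)) (ha : ∀ (g : G) (x : X), a (g • x) = g • a x)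
    (hb : ∀ (g : G) (y : Y), b (g • y) = g • b y) :
    GHomotopic G ((b.comp f).comp a) (b.comp a) := by
  obtain ⟨H, hH⟩ := h
  refine ⟨⟨⟨fun p => b (H (p.1, a p.2)), by fun_prop⟩, fun x => ?_, fun x => ?_⟩, fun g t x => ?_⟩
  · simp
  · simp
  · change b (H (t, a (g • x))) = g • b (H (t, a x))
    rw [ha, hH, hb]

theorem GHomotopyEquivalent.refl : GHomotopyEquivalent G X X :=
  ⟨ContinuousMap.id X, ContinuousMap.id X, fun _ _ => rfl, fun _ _ => rfl,
    GHomotopic.refl _ fun _ _ => rfl, GHomotopic.refl _ fun _ _ => rfl⟩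

theorem GHomotopyEquivalent.symm (h : GHomotopyEquivalent G X Y) : GHomotopyEquivalent G Y X := by
  obtain ⟨f, f', hf, hf', h1, h2⟩ := h
  exact ⟨f', f, hf', hf, h2, h1⟩

theorem GHomotopyEquivalent.trans (h : GHomotopyEquivalent G X Y)
    (h' : GHomotopyEquivalent G Y Z) : GHomotopyEquivalent G X Z := by
  obtain ⟨a, a', ha, ha', h1, h2⟩ := h
  obtain ⟨b, b', hb, hb', h3, h4⟩ := h'
  refine ⟨b.comp a, a'.comp b', fun g x => ?_, fun g x => ?_, ?_, ?_⟩
  · simp [ha, hb]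
  · simp [ha', hb']
  · exact (h3.conj a a' ha ha').trans h1
  · exact (h2.conj b' b hb' hb).trans h4

end GHomotopy

/-! ### The deformation on the nerve -/

namespace Nerve

/-! ### Compatibility of the deformation with the group action. -/

section Equivariance

variable {G X : Type*} [Group G] [MulAction G X]

/-- The decidability instances are arbitrary implicit arguments, so that the lemma unifies with
whichever instances the filters carry. -/
theorem sum_filter_smul [Fintype X] (g : G) (P P' : X → Prop) {_ : DecidablePred P} {_ : DecidablePred P'}
    (f f' : X → ℝ) (hP : ∀ x, P' (g • x) ↔ P x) (hf : ∀ x, P x → f' (g • x) = f x) :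
    ∑ x with P' x, f' x = ∑ x with P x, f x := by
  symm
  refine Finset.sum_equiv (MulAction.toPerm g) (fun x => ?_) fun x hx => ?_
  · simp [hP]
  · exact (hf x (by simpa using hx)).symm

variable [PartialOrder X] [CovariantClass G X (fun g x => g • x) (fun x y => x ≤ y)]

theorem smul_le_smul_iff' (g : G) {x y : X} : g • x ≤ g • y ↔ x ≤ y := by
  refine ⟨fun h => ?_, fun h => CovariantClass.elim (μ := fun (g : G) (x : X) => g • x)
    (r := fun x y => x ≤ y) g h⟩
  have := CovariantClass.elim (μ := fun (g : G) (x : X) => g • x) (r := fun x y => x ≤ y) g⁻¹ h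
  simpa using this

theorem smul_lt_smul_iff' (g : G) {x y : X} : g • x < g • y ↔ x < y := by
  rw [lt_iff_le_not_ge, lt_iff_le_not_ge, smul_le_smul_iff', smul_le_smul_iff']

variable [Fintype X] {w w' : X → ℝ} (g : G) (hw : ∀ x, w' (g • x) = w x)
include hw

theorem massAbove_smul (x : X) : massAbove (g • x) w' = massAbove x w := by
  unfold massAbove
  exact sum_filter_smul g _ _ _ _ (fun _ => smul_lt_smul_iff' g) fun x _ => hw x

theorem lowerPart_smul (x q : X) (a : ℝ) :
    lowerPart (g • x) w' a (g • q) = lowerPart x w a q := by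
  have h1 : massUpTo (g • x) w' (g • q) = massUpTo x w q := by
    unfold massUpTo
    exact sum_filter_smul g _ _ _ _ (fun _ => by rw [smul_lt_smul_iff' g, smul_le_smul_iff' g])
      fun x _ => hw x
  have h2 : massBefore (g • x) w' (g • q) = massBefore x w q := by
    unfold massBefore
    exact sum_filter_smul g _ _ _ _ (fun _ => by rw [smul_lt_smul_iff' g, smul_lt_smul_iff' g])
      fun x _ => hw x
  rw [lowerPart, lowerPart, h1, h2]

theorem moved_smul {n m : X → X → X} {r : X → X} (x z : X) (s : ℝ)
    (hn : ∀ q, x < q → n (g • x) (g • q) = g • n x q)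
    (hm : ∀ q, x < q → m (g • x) (g • q) = g • m x q) (hr : r (g • x) = g • r x) :
    moved n m r (g • x) w' s (g • z) = moved n m r x w s z := by
  classical
  have hs : ∀ y : X, (Pi.single (g • y) 1 : X → ℝ) (g • z) = (Pi.single y 1 : X → ℝ) z := by
    intro y
    simp [Pi.single_apply]
  unfold moved
  rw [massAbove_smul g hw, hr, hs]
  congr 1
  refine sum_filter_smul g _ _ _ _ (fun _ => smul_lt_smul_iff' g) fun q hq => ?_
  rw [hn q hq, hm q hq, hs, hs, hs, hw]
  simp only [lowerPart_smul g hw]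

theorem pushOff_smul {D : Set X} {n m : X → X → X} {r : X → X} (z : X) (t : ℝ)
    (hD : ∀ x, g • x ∈ D ↔ x ∈ D)
    (hn : ∀ x ∈ D, ∀ q, x < q → n (g • x) (g • q) = g • n x q)
    (hm : ∀ x ∈ D, ∀ q, x < q → m (g • x) (g • q) = g • m x q)
    (hr : ∀ x ∈ D, r (g • x) = g • r x) :
    pushOff D n m r t w' (g • z) = pushOff D n m r t w z := by
  classical
  unfold pushOff
  rw [hw]
  simp only [hD]
  congr 1
  refine sum_filter_smul g _ _ _ _ hD fun x hx => ?_
  rw [hw, moved_smul g hw x z _ (hn x hx) (hm x hx) (hr x hx)]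
  simp only [smul_lt_smul_iff' g]

end Equivariance

/-! ### Normalized deformation, inclusion and restriction of nerves. -/

section Maps

variable {X : Type*} [PartialOrder X] [Fintype X]

theorem nonneg (f : Nerve X) (x : X) : 0 ≤ f.1 x := f.2.1.1 x

theorem sum_eq_one (f : Nerve X) : ∑ x, f.1 x = 1 := f.2.1.2

/-- The deformation `pushOff`, normalized. -/
def deform {D : Set X} {n m : X → X → X} {r : X → X} (hD : IsUpperContraction D n m r)
    (t : unitInterval) (f : Nerve X) : Nerve X :=
  ⟨fun z => pushOff D n m r t f.1 z / ∑ y, pushOff D n m r t f.1 y,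
    ⟨fun z => div_nonneg (pushOff_nonneg hD f.nonneg f.2.2 t.2.2 z)
      (sum_pushOff_pos hD f.nonneg f.2.2 f.sum_eq_one t.2.2).le, by
      rw [← Finset.sum_div]
      exact div_self (sum_pushOff_pos hD f.nonneg f.2.2 f.sum_eq_one t.2.2).ne'⟩,
    (pushOff_chain hD f.nonneg f.2.2 t).mono fun _ hz => (div_ne_zero_iff.1 hz).1⟩

theorem deform_eq_self {D : Set X} {n m : X → X → X} {r : X → X}
    (hD : IsUpperContraction D n m r) {t : unitInterval} {f : Nerve X}
    (h : pushOff D n m r t f.1 = f.1) : deform hD t f = f := by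
  refine Subtype.ext (funext fun z => ?_)
  change pushOff D n m r t f.1 z / ∑ y, pushOff D n m r t f.1 y = f.1 z
  rw [h, f.sum_eq_one, div_one]

theorem continuous_deform {D : Set X} {n m : X → X → X} {r : X → X}
    (hD : IsUpperContraction D n m r) :
    Continuous fun p : unitInterval × Nerve X => deform hD p.1 p.2 := by
  have h : ∀ z, Continuous fun p : unitInterval × Nerve X => pushOff D n m r p.1 p.2.1 z := by
    intro z
    have hc : Continuous fun p : unitInterval × Nerve X => ((p.1 : ℝ), p.2.1) :=
      (continuous_subtype_val.comp continuous_fst).prodMk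
        (continuous_subtype_val.comp continuous_snd)
    exact (continuous_pushOff D n m r z).comp hc
  refine Continuous.subtype_mk (continuous_pi fun z => ?_) _
  exact (h z).div (continuous_finsetSum _ fun y _ => h y) fun p =>
    (sum_pushOff_pos hD p.2.nonneg p.2.2.2 p.2.sum_eq_one p.1.2.2).ne'

variable {Y : Type*} [PartialOrder Y] [Fintype Y]

theorem sum_comp_embedding (i : Y ↪o X) {f : X → ℝ} (hf : ∀ x, x ∉ Set.range i → f x = 0) :
    ∑ y, f (i y) = ∑ x, f x := by
  exact Fintype.sum_of_injective i i.injective _ _ hf fun _ => rfl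

/-- The inclusion of nerves given by an order embedding. -/
def incl (i : Y ↪o X) (v : Nerve Y) : Nerve X :=
  ⟨Function.extend i v.1 0, ⟨fun x => by
      by_cases hx : ∃ y, i y = x
      · obtain ⟨y, rfl⟩ := hx
        rw [i.injective.extend_apply]
        exact v.nonneg y
      · rw [Function.extend_apply' _ _ _ hx]; rfl, by
      rw [← sum_comp_embedding i]
      · simp only [i.injective.extend_apply]
        exact v.sum_eq_one
      · intro x hx
        rw [Function.extend_apply' _ _ _ (by simpa using hx)]; rfl⟩, by
    have h : ∀ x, Function.extend i v.1 0 x ≠ 0 → ∃ y, i y = x ∧ v.1 y ≠ 0 := by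
      intro x hx
      by_cases hx' : ∃ y, i y = x
      · obtain ⟨y, rfl⟩ := hx'
        rw [i.injective.extend_apply] at hx
        exact ⟨y, rfl, hx⟩
      · rw [Function.extend_apply' _ _ _ hx'] at hx
        exact absurd rfl hx
    intro a ha b hb _
    obtain ⟨y, rfl, hy⟩ := h a ha
    obtain ⟨y', rfl, hy'⟩ := h b hb
    exact (v.2.2.total hy hy').imp i.le_iff_le.2 i.le_iff_le.2⟩

theorem incl_apply (i : Y ↪o X) (v : Nerve Y) (y : Y) : (incl i v).1 (i y) = v.1 y :=
  i.injective.extend_apply _ _ _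

theorem incl_apply_of_notMem (i : Y ↪o X) (v : Nerve Y) {x : X} (hx : x ∉ Set.range i) :
    (incl i v).1 x = 0 :=
  Function.extend_apply' _ _ _ (by simpa using hx)

theorem continuous_incl (i : Y ↪o X) : Continuous (incl i) := by
  refine Continuous.subtype_mk (continuous_pi fun x => ?_) _
  by_cases hx : ∃ y, i y = x
  · obtain ⟨y, rfl⟩ := hx
    simp only [i.injective.extend_apply]
    exact (continuous_apply y).comp continuous_subtype_val
  · simp only [Function.extend_apply' _ _ _ hx]
    exact continuous_const

/-- The restriction to a subposet of weights supported there. -/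
def restrict (i : Y ↪o X) (f : Nerve X) (hf : ∀ x, x ∉ Set.range i → f.1 x = 0) : Nerve Y :=
  ⟨fun y => f.1 (i y), ⟨fun _ => f.nonneg _, (sum_comp_embedding i hf).trans f.sum_eq_one⟩,
    fun _ ha _ hb _ => (f.2.2.total ha hb).imp i.le_iff_le.1 i.le_iff_le.1⟩

theorem incl_restrict (i : Y ↪o X) (f : Nerve X) (hf : ∀ x, x ∉ Set.range i → f.1 x = 0) :
    incl i (restrict i f hf) = f := by
  refine Subtype.ext (funext fun x => ?_)
  by_cases hx : x ∈ Set.range i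
  · obtain ⟨y, rfl⟩ := hx
    exact incl_apply i _ y
  · rw [incl_apply_of_notMem i _ hx, hf x hx]

end Maps

/-! ### Removing elements with contractible upper links. -/

section Equivalence

variable {G X Y : Type*} [Group G] [PartialOrder X] [Fintype X] [PartialOrder Y] [Fintype Y]
  [MulAction G X] [CovariantClass G X (fun g x => g • x) (fun x y => x ≤ y)]
  [MulAction G Y] [CovariantClass G Y (fun g x => g • x) (fun x y => x ≤ y)]

theorem smul_apply (g : G) (f : Nerve X) (x : X) : (g • f).1 x = f.1 (g⁻¹ • x) := rfl

theorem smul_apply_smul (g : G) (f : Nerve X) (x : X) : (g • f).1 (g • x) = f.1 x := by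
  rw [smul_apply, inv_smul_smul]

/-- Elements whose upper links are contractible through an equivariant zigzag of order preserving
maps may be removed from a `G`-poset without changing its `G`-homotopy type. -/
theorem gHomotopyEquivalent_of_isUpperContraction (i : Y ↪o X)
    (hi : ∀ (g : G) (y : Y), i (g • y) = g • i y) {n m : X → X → X} {r : X → X}
    (hD : IsUpperContraction (Set.range i)ᶜ n m r)
    (hn : ∀ (g : G), ∀ x ∈ (Set.range i)ᶜ, ∀ q, x < q → n (g • x) (g • q) = g • n x q)
    (hm : ∀ (g : G), ∀ x ∈ (Set.range i)ᶜ, ∀ q, x < q → m (g • x) (g • q) = g • m x q)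
    (hr : ∀ (g : G), ∀ x ∈ (Set.range i)ᶜ, r (g • x) = g • r x) :
    GHomotopyEquivalent G (Nerve Y) (Nerve X) := by
  have hDg' : ∀ (g : G) x, x ∈ Set.range i → g • x ∈ Set.range i := by
    rintro g _ ⟨y, rfl⟩
    exact ⟨g • y, hi g y⟩
  have hDg : ∀ (g : G) x, g • x ∈ (Set.range i)ᶜ ↔ x ∈ (Set.range i)ᶜ := by
    intro g x
    refine not_congr ⟨fun h => ?_, hDg' g x⟩
    simpa using hDg' g⁻¹ _ h
  have hdeform : ∀ (g : G) (t : unitInterval) (f : Nerve X),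
      deform hD t (g • f) = g • deform hD t f := by
    intro g t f
    have key : ∀ z, pushOff (Set.range i)ᶜ n m r t (g • f).1 (g • z)
        = pushOff (Set.range i)ᶜ n m r t f.1 z := fun z =>
      pushOff_smul g (smul_apply_smul g f) z t (hDg g) (hn g) (hm g) (hr g)
    refine Subtype.ext (funext fun z => ?_)
    obtain ⟨z, rfl⟩ := MulAction.surjective g z
    rw [smul_apply_smul]
    change _ / _ = _ / _
    rw [key, ← Equiv.sum_comp (MulAction.toPerm g)]
    simp only [MulAction.toPerm_apply, key]
  have hone : ∀ f : Nerve X, ∀ x, x ∉ Set.range i → (deform hD 1 f).1 x = 0 := by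
    intro f x hx
    change pushOff _ n m r ((1 : unitInterval) : ℝ) f.1 x / _ = 0
    rw [Set.Icc.coe_one, pushOff_one_eq_zero hD f.nonneg f.2.2 hx, zero_div]
  let ι : C(Nerve Y, Nerve X) := ⟨incl i, continuous_incl i⟩
  have hcont1 : Continuous fun f : Nerve X => deform hD 1 f :=
    (continuous_deform hD).comp (by fun_prop : Continuous fun f : Nerve X => ((1 : unitInterval), f))
  let ρ : C(Nerve X, Nerve Y) := ⟨fun f => restrict i (deform hD 1 f) (hone f), by
    refine Continuous.subtype_mk (continuous_pi fun y => ?_) _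
    exact (continuous_apply (i y)).comp (continuous_subtype_val.comp hcont1)⟩
  have hιρ : ∀ f, ι (ρ f) = deform hD 1 f := fun f => incl_restrict i _ (hone f)
  -- Weights supported on `Y` do not move, so this composite is equal to the identity, not merely
  -- homotopic to it.
  have hρι : ∀ v, ρ (ι v) = v := by
    intro v
    have h : deform hD 1 (ι v) = ι v := deform_eq_self hD
      (pushOff_of_eq_zero (ι v).nonneg _ fun x hx => incl_apply_of_notMem i v hx)
    refine Subtype.ext (funext fun y => ?_)
    change (deform hD 1 (ι v)).1 (i y) = v.1 y
    rw [h]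
    exact incl_apply i v y
  have hι : ∀ (g : G) (v : Nerve Y), ι (g • v) = g • ι v := by
    intro g v
    refine Subtype.ext (funext fun x => ?_)
    obtain ⟨x, rfl⟩ := MulAction.surjective g x
    change (ι (g • v)).1 (g • x) = _
    rw [smul_apply_smul]
    by_cases hx : x ∈ Set.range i
    · obtain ⟨y, rfl⟩ := hx
      rw [← hi]
      exact (incl_apply i _ _).trans ((smul_apply_smul g v y).trans (incl_apply i _ _).symm)
    · exact (incl_apply_of_notMem i _ ((hDg g x).2 hx)).trans (incl_apply_of_notMem i _ hx).symm
  have hρ : ∀ (g : G) (f : Nerve X), ρ (g • f) = g • ρ f := by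
    intro g f
    refine Subtype.ext (funext fun y => ?_)
    obtain ⟨y, rfl⟩ := MulAction.surjective g y
    rw [smul_apply_smul]
    change (deform hD 1 (g • f)).1 (i (g • y)) = (deform hD 1 f).1 (i y)
    rw [hdeform, hi, smul_apply_smul]
  refine ⟨ι, ρ, hι, hρ, ?_, ?_⟩
  · have : ρ.comp ι = ContinuousMap.id _ := ContinuousMap.ext hρι
    rw [this]
    exact GHomotopic.refl _ fun _ _ => rfl
  -- The deformation starts at the identity and ends at `ι ∘ ρ`, opposite to the direction required.
  · refine GHomotopic.symm ⟨⟨⟨fun p => deform hD p.1 p.2, continuous_deform hD⟩,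
      fun f => ?_, fun f => (hιρ f).symm⟩, hdeform⟩
    refine deform_eq_self hD ?_
    rw [Set.Icc.coe_zero, pushOff_zero f.nonneg]

end Equivalence

/-! ### Order reversal and lower links. -/

section Dual

variable {G X Y : Type*} [Group G] [PartialOrder X] [Fintype X] [PartialOrder Y] [Fintype Y]
  [MulAction G X] [CovariantClass G X (fun g x => g • x) (fun x y => x ≤ y)]
  [MulAction G Y] [CovariantClass G Y (fun g x => g • x) (fun x y => x ≤ y)]

instance : CovariantClass G Xᵒᵈ (fun g x => g • x) (fun x y => x ≤ y) where
  elim g _ _ h := CovariantClass.elim (μ := fun (g : G) (x : X) => g • x)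
    (r := fun x y => x ≤ y) g h

/-- A poset and its opposite have the same chains, so the identity on weights is an isomorphism. -/
theorem gHomotopyEquivalent_dual : GHomotopyEquivalent G (Nerve X) (Nerve Xᵒᵈ) := by
  let a : C(Nerve X, Nerve Xᵒᵈ) := ⟨fun f => ⟨f.1, f.2.1, f.2.2.symm⟩,
    Continuous.subtype_mk continuous_subtype_val _⟩
  let b : C(Nerve Xᵒᵈ, Nerve X) := ⟨fun f => ⟨f.1, f.2.1, f.2.2.symm⟩,
    Continuous.subtype_mk continuous_subtype_val _⟩
  exact ⟨a, b, fun _ _ => rfl, fun _ _ => rfl, GHomotopic.refl _ fun _ _ => rfl,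
    GHomotopic.refl _ fun _ _ => rfl⟩

/-- Elements whose lower links are equivariantly conically contractible may be removed from a
`G`-poset without changing its `G`-homotopy type. -/
theorem gHomotopyEquivalent_of_lower_cone (i : Y ↪o X)
    (hi : ∀ (g : G) (y : Y), i (g • y) = g • i y) {m : X → X → X} {r : X → X}
    (hanti : ∀ x ∈ (Set.range i)ᶜ, ∀ y ∈ (Set.range i)ᶜ, x ≤ y → x = y)
    (m_mono : ∀ x ∈ (Set.range i)ᶜ, ∀ q q', q ≤ q' → q' < x → m x q ≤ m x q')
    (m_lt : ∀ x ∈ (Set.range i)ᶜ, ∀ q, q < x → m x q < x)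
    (le_m : ∀ x ∈ (Set.range i)ᶜ, ∀ q, q < x → q ≤ m x q)
    (r_lt : ∀ x ∈ (Set.range i)ᶜ, r x < x)
    (r_le_m : ∀ x ∈ (Set.range i)ᶜ, ∀ q, q < x → r x ≤ m x q)
    (hm : ∀ (g : G), ∀ x ∈ (Set.range i)ᶜ, ∀ q, q < x → m (g • x) (g • q) = g • m x q)
    (hr : ∀ (g : G), ∀ x ∈ (Set.range i)ᶜ, r (g • x) = g • r x) :
    GHomotopyEquivalent G (Nerve Y) (Nerve X) := by
  refine gHomotopyEquivalent_dual.trans (GHomotopyEquivalent.trans ?_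
    gHomotopyEquivalent_dual.symm)
  -- In the opposite order the cone `q ≤ m x q ≥ r x` is a zigzag whose third term is constantly `r
  -- x`, so its last leg is trivial.
  refine gHomotopyEquivalent_of_isUpperContraction (X := Xᵒᵈ) (Y := Yᵒᵈ) i.dual hi
    (n := m) (m := fun x _ => r x) (r := r) ?_ hm (fun g x hx _ _ => hr g x hx) hr
  exact {
    antichain := fun x hx y hy h => (hanti y hy x hx h).symm
    n_mono := fun x hx q q' h h' => m_mono x hx q' q h' h
    m_mono := fun x _ _ _ _ _ => le_refl (α := X) (r x)
    lt_n := m_lt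
    n_le := le_m
    n_le_m := r_le_m
    lt_r := r_lt
    r_le_m := fun x _ _ _ => le_refl (α := X) (r x) }

end Dual

end Nerve

/-! ### The subgroup `O_p(H)`. -/

section PCore

variable {G : Type*} [Group G] {p : ℕ}

theorem pCoreOf_le (H : Subgroup G) : pCoreOf p H ≤ H := Subgroup.map_subtype_le _

theorem le_pCoreOf {N H : Subgroup G} (hNH : N ≤ H) (hn : H ≤ Subgroup.normalizer (N : Set G))
    (hN : IsPGroup p N) : N ≤ pCoreOf p H := by
  have h1 : N.subgroupOf H ≤ pCore p H :=
    le_sSup ⟨Subgroup.normal_subgroupOf_of_le_normalizer hn, hN.comap_subtype⟩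
  intro x hx
  exact ⟨⟨x, hNH hx⟩, h1 hx, rfl⟩

theorem mem_normalizer_of_map_conj_eq {K : Subgroup G} {g : G}
    (h : K.map (MulAut.conj g).toMonoidHom = K) : g ∈ Subgroup.normalizer (K : Set G) :=
  Subgroup.mem_normalizer_iff_map_conj_eq.2 h

theorem map_conj_eq_of_mem_normalizer {K : Subgroup G} {g : G}
    (h : g ∈ Subgroup.normalizer (K : Set G)) : K.map (MulAut.conj g).toMonoidHom = K :=
  Subgroup.mem_normalizer_iff_map_conj_eq.1 h

theorem normalizer_le_normalizer_pCoreOf (H : Subgroup G) :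
    Subgroup.normalizer (H : Set G) ≤ Subgroup.normalizer (pCoreOf p H : Set G) := by
  intro g hg
  refine mem_normalizer_of_map_conj_eq ?_
  rw [map_pCoreOf, map_conj_eq_of_mem_normalizer hg]

/-- For a Sylow subgroup `S` and a normal `p`-subgroup `N`, the join `S N` is a `p`-group, so
maximality of `S` gives `N ≤ S`; hence the join of all such `N` lies in `S`. -/
theorem isPGroup_pCore [Finite G] [Fact p.Prime] : IsPGroup p (pCore p G) := by
  obtain ⟨S⟩ : Nonempty (Sylow p G) := inferInstance
  refine S.isPGroup'.to_le (sSup_le fun N hN => ?_)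
  have := hN.1
  have h1 := IsPGroup.to_sup_of_normal_right S.isPGroup' hN.2
  exact le_sup_right.trans (S.is_maximal' h1 le_sup_left).le

theorem isPGroup_pCoreOf [Finite G] [Fact p.Prime] (H : Subgroup G) :
    IsPGroup p (pCoreOf p H) :=
  isPGroup_pCore.map _

theorem hasCharacteristic_iff {H : Subgroup G} : HasCharacteristic p H ↔
    ∀ y ∈ H, (∀ v ∈ pCoreOf p H, Commute v y) → y ∈ pCoreOf p H := by
  constructor
  · intro h y hy hc
    refine ⟨⟨y, hy⟩, h (Subgroup.mem_centralizer_iff.2 fun v hv => Subtype.ext ?_), rfl⟩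
    exact hc v ⟨v, hv, rfl⟩
  · intro h y hy
    obtain ⟨z, hz, hzy⟩ := h y y.2 (by
      rintro _ ⟨v, hv, rfl⟩
      exact congrArg Subtype.val (Subgroup.mem_centralizer_iff.1 hy v hv))
    rwa [← Subtype.ext hzy]

end PCore

/-! ### Coprime action and Thompson's `A × B` lemma. -/

section Coprime

variable {G : Type*} [Group G] {p : ℕ}

/-- Raising an element to the `p`-part of its order leaves an element of order prime to `p`. -/
theorem isPGroup_of_forall_coprime [Finite G] [Fact p.Prime] {D : Subgroup G}
    (h : ∀ y ∈ D, ¬ p ∣ orderOf y → y = 1) : IsPGroup p D := by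
  have hp : p.Prime := Fact.out
  rintro ⟨g, hg⟩
  obtain ⟨k, m, hm, hk⟩ :=
    Nat.exists_eq_pow_mul_and_not_dvd (orderOf_pos g).ne' p hp.ne_one
  refine ⟨k, Subtype.ext (h _ (D.pow_mem hg _) ?_)⟩
  change ¬ p ∣ orderOf (g ^ p ^ k)
  have hpk : 0 < p ^ k := pow_pos hp.pos k
  rw [orderOf_pow, hk, Nat.gcd_eq_right (Dvd.intro _ rfl), Nat.mul_div_cancel_left _ hpk]
  exact hm

/-- A coprime automorphism acting trivially modulo fixed elements fixes. -/
theorem commute_of_commute_commutator {y v : G} {V : Subgroup G} (hp : p.Prime)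
    (hV : IsPGroup p V) (hy : ¬ p ∣ orderOf y) (hc : v⁻¹ * (y * v * y⁻¹) ∈ V)
    (hyc : Commute y (v⁻¹ * (y * v * y⁻¹))) : Commute y v := by
  set c := v⁻¹ * (y * v * y⁻¹) with hcdef
  have h1 : y * v = v * c * y := by rw [hcdef]; group
  have h2 : ∀ k : ℕ, y ^ k * v = v * c ^ k * y ^ k := by
    intro k
    induction k with
    | zero => simp
    | succ k ih =>
      rw [pow_succ', mul_assoc, ih, ← mul_assoc, ← mul_assoc, h1, mul_assoc (v * c),
        (hyc.pow_right k).eq, pow_succ' c]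
      simp only [mul_assoc]
  -- Taking `k = orderOf y` in `h2` kills `y ^ k`. The order of `c` then divides both `orderOf y`
  -- and a power of `p`.
  have h3 : c ^ orderOf y = 1 := by
    have := h2 (orderOf y)
    rw [pow_orderOf_eq_one, one_mul, mul_one] at this
    exact mul_left_cancel (this.symm.trans (mul_one v).symm)
  obtain ⟨k, hk⟩ := hV ⟨c, hc⟩
  have hk : c ^ p ^ k = 1 := congrArg Subtype.val hk
  have h4 : orderOf c ∣ 1 := by
    have hcop : Nat.Coprime (p ^ k) (orderOf y) :=
      Nat.Coprime.pow_left k ((Nat.Prime.coprime_iff_not_dvd hp).2 hy)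
    rw [← hcop]
    exact Nat.dvd_gcd (orderOf_dvd_of_pow_eq_one hk) (orderOf_dvd_of_pow_eq_one h3)
  have h5 : c = 1 := orderOf_eq_one_iff.1 (Nat.dvd_one.1 h4)
  rw [h5, mul_one] at h1
  exact h1

/-- The `p`-group `V P` is nilpotent. If `[V, P] = V`, every term of its lower central series would
contain `V`. -/
theorem commutator_ne_self [Finite G] [Fact p.Prime] {V P : Subgroup G} (hV : IsPGroup p V)
    (hP : IsPGroup p P) (hPV : P ≤ Subgroup.normalizer (V : Set G)) (hne : V ≠ ⊥) :
    ⁅V, P⁆ ≠ V := by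
  intro h
  have hW : IsPGroup p (V ⊔ P : Subgroup G) := hV.to_sup_of_normal_left' hP hPV
  obtain ⟨n, hn⟩ := (Subgroup.isNilpotent_iff_lowerCentralSeries (V ⊔ P)).1 hW.isNilpotent
  have : ∀ k, V ≤ (V ⊔ P).lowerCentralSeries k := by
    intro k
    induction k with
    | zero => exact le_sup_left
    | succ k ih =>
      rw [Subgroup.lowerCentralSeries_succ]
      exact h.symm.le.trans (Subgroup.commutator_mono ih le_sup_right)
  exact hne (le_bot_iff.1 (hn ▸ this n))

/-- Thompson's `A × B` lemma for a single element `y` of order prime to `p`. -/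
theorem commute_of_commute_fixedPoints [Finite G] [Fact p.Prime] {P : Subgroup G}
    (hP : IsPGroup p P) {y : G} (hyP : ∀ b ∈ P, Commute y b) (hy : ¬ p ∣ orderOf y)
    (V : Subgroup G) (hV : IsPGroup p V) (hPV : P ≤ Subgroup.normalizer (V : Set G))
    (hyV : y ∈ Subgroup.normalizer (V : Set G))
    (hC : ∀ v ∈ V, (∀ b ∈ P, Commute b v) → Commute y v) : ∀ v ∈ V, Commute y v := by
  induction hk : Nat.card V using Nat.strong_induction_on generalizing V with
  | _ k ih =>
  by_cases hne : V = ⊥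
  · subst hne
    intro v hv
    rw [Subgroup.mem_bot.1 hv]
    exact Commute.one_right y
  have hle : ⁅V, P⁆ ≤ V := Subgroup.commutator_le.2 fun v hv b hb => by
    rw [commutatorElement_def, mul_assoc, mul_assoc, ← mul_assoc b]
    exact V.mul_mem hv ((Subgroup.mem_normalizer_iff.1 (hPV hb) _).1 (V.inv_mem hv))
  have hlt : ⁅V, P⁆ < V := lt_of_le_of_ne hle (commutator_ne_self hV hP hPV hne)
  have hyNP : y ∈ Subgroup.normalizer (P : Set G) := by
    refine Subgroup.mem_normalizer_iff.2 fun b => ⟨fun hb => ?_, fun hb => ?_⟩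
    · rwa [(hyP b hb).eq, mul_inv_cancel_right]
    · have := (hyP _ hb).eq
      have h2 : b = y * b * y⁻¹ := by
        have h3 : y * b = y * (y * b * y⁻¹) := by rw [this]; group
        exact mul_left_cancel h3
      rwa [h2]
  have hnorm : ∀ g, g ∈ Subgroup.normalizer (V : Set G) → g ∈ Subgroup.normalizer (P : Set G) →
      g ∈ Subgroup.normalizer ((⁅V, P⁆ : Subgroup G) : Set G) := by
    intro g h1 h2
    refine mem_normalizer_of_map_conj_eq ?_
    rw [Subgroup.map_commutator, map_conj_eq_of_mem_normalizer h1,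
      map_conj_eq_of_mem_normalizer h2]
  -- The smaller group `[V, P]` is normalized by `P` and `y`, so induction applies to it.
  have hcomm : ∀ v ∈ ⁅V, P⁆, Commute y v :=
    ih _ (hk ▸ Set.ncard_lt_ncard (SetLike.coe_ssubset_coe.2 hlt)) ⁅V, P⁆ (hV.to_le hle)
      (fun b hb => hnorm b (hPV hb) (Subgroup.le_normalizer hb)) (hnorm y hyV hyNP)
      (fun v hv => hC v (hle hv)) rfl
  -- Three subgroups lemma, from `[y, P] = 1` and `[[P, V], y] = 1`. Hence `[V, y]` consists of
  -- `P`-fixed points, which `y` centralizes by `hC`.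
  have key : ⁅⁅V, Subgroup.zpowers y⁆, P⁆ = ⊥ := by
    refine Subgroup.commutator_commutator_eq_bot_of_rotate ?_ ?_
    · have : ⁅Subgroup.zpowers y, P⁆ = ⊥ := by
        rw [Subgroup.commutator_eq_bot_iff_le_centralizer, Subgroup.zpowers_le]
        exact Subgroup.mem_centralizer_iff.2 fun b hb => (hyP b hb).eq.symm
      rw [this, Subgroup.commutator_bot_left]
    · rw [Subgroup.commutator_comm P V, Subgroup.commutator_comm,
        Subgroup.commutator_eq_bot_iff_le_centralizer, Subgroup.zpowers_le]
      exact Subgroup.mem_centralizer_iff.2 fun b hb => (hcomm b hb).eq.symm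
  intro v hv
  have hcV : v⁻¹ * (y * v * y⁻¹) ∈ V :=
    V.mul_mem (V.inv_mem hv) ((Subgroup.mem_normalizer_iff.1 hyV v).1 hv)
  refine commute_of_commute_commutator Fact.out hV hy hcV (hC _ hcV fun b hb => ?_)
  have h1 : v⁻¹ * (y * v * y⁻¹) ∈ ⁅V, Subgroup.zpowers y⁆ := by
    have := Subgroup.commutator_mem_commutator (V.inv_mem hv) (Subgroup.mem_zpowers y)
    rwa [commutatorElement_def, inv_inv, mul_assoc, mul_assoc, ← mul_assoc y] at this
  exact Subgroup.mem_centralizer_iff.1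
    ((Subgroup.commutator_eq_bot_iff_le_centralizer.1 key) h1) b hb

end Coprime

/-! ### Distinguished subgroups and characteristic `p` of their normalizers. -/

section Distinguished

variable {G : Type*} [Group G] {p : ℕ}

theorem mem_centerOf {P : Subgroup G} {x : G} :
    x ∈ centerOf P ↔ x ∈ P ∧ ∀ y ∈ P, Commute y x := by
  constructor
  · rintro ⟨z, hz, rfl⟩
    exact ⟨z.2, fun y hy => congrArg Subtype.val (Subgroup.mem_center_iff.1 hz ⟨y, hy⟩)⟩
  · rintro ⟨hx, h⟩
    exact ⟨⟨x, hx⟩, Subgroup.mem_center_iff.2 fun y => Subtype.ext (h y y.2), rfl⟩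

theorem omegaOne_le (A : Subgroup G) : omegaOne p A ≤ A :=
  (Subgroup.closure_le _).2 fun _ h => h.1

theorem distinguishedPart_le_centerOf (P : Subgroup G) : distinguishedPart p P ≤ centerOf P :=
  (Subgroup.closure_le _).2 fun _ h => omegaOne_le _ h.1

theorem centerOf_le (P : Subgroup G) : centerOf P ≤ P := Subgroup.map_subtype_le _

theorem mem_distinguishedPart {P : Subgroup G} {x : G} (hx : x ∈ centerOf P)
    (hc : x ∈ pCentralElements p G) : x ∈ distinguishedPart p P :=
  Subgroup.subset_closure
    ⟨Subgroup.subset_closure ⟨hx, by rw [← hc.1]; exact pow_orderOf_eq_one x⟩, hc⟩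

theorem distinguishedPart_ne_bot_iff (hp : p.Prime) {P : Subgroup G} :
    distinguishedPart p P ≠ ⊥ ↔ ∃ x ∈ centerOf P, x ∈ pCentralElements p G := by
  constructor
  · intro h
    by_contra! hcon
    refine h (le_bot_iff.1 ((Subgroup.closure_le _).2 fun x hx => ?_))
    exact absurd hx.2 (hcon x (omegaOne_le _ hx.1))
  · rintro ⟨x, hx, hc⟩ h
    have h1 : x = 1 := Subgroup.mem_bot.1 (h ▸ mem_distinguishedPart hx hc)
    have h2 := hc.1
    rw [h1, orderOf_one] at h2
    exact hp.ne_one h2.symm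

/-- In a group of parabolic characteristic `p`, the normalizer of a distinguished `p`-subgroup has
characteristic `p`. -/
theorem HasParabolicCharacteristic.hasCharacteristic_normalizer [Finite G] [Fact p.Prime]
    (hG : HasParabolicCharacteristic p G) {P : Subgroup G} (hP : IsPGroup p P)
    (hPd : distinguishedPart p P ≠ ⊥) :
    HasCharacteristic p (Subgroup.normalizer (P : Set G)) := by
  have hp : p.Prime := Fact.out
  obtain ⟨x, hxP, hxo, S, hxS⟩ := (distinguishedPart_ne_bot_iff hp).1 hPd
  set H := Subgroup.normalizer (P : Set G) with hH
  set R := pCoreOf p H with hR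
  have hHR : H ≤ Subgroup.normalizer (R : Set G) :=
    Subgroup.le_normalizer.trans (normalizer_le_normalizer_pCoreOf H)
  have hPR : P ≤ R := le_pCoreOf Subgroup.le_normalizer le_rfl hP
  set L := Subgroup.normalizer ((Subgroup.zpowers x : Subgroup G) : Set G) with hL
  have hcL : ∀ y, Commute y x → y ∈ L := by
    intro y hy
    refine mem_normalizer_of_map_conj_eq ?_
    rw [MonoidHom.map_zpowers]
    congr 1
    change y * x * y⁻¹ = x
    rw [hy.eq, mul_inv_cancel_right]
  have hLchar : HasCharacteristic p L := by
    refine hG L ⟨_, ?_, ?_, rfl⟩ ⟨S, fun y hy => hcL y ((mem_centerOf.1 hxS).2 y hy)⟩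
    · rw [Ne, Subgroup.zpowers_eq_bot]
      rintro rfl
      rw [orderOf_one] at hxo
      exact hp.ne_one hxo.symm
    · exact IsPGroup.of_card (n := 1) (by rw [Nat.card_zpowers, hxo, pow_one])
  set V := pCoreOf p L with hV
  have hLV : L ≤ Subgroup.normalizer (V : Set G) :=
    Subgroup.le_normalizer.trans (normalizer_le_normalizer_pCoreOf L)
  have hVp : IsPGroup p V := isPGroup_pCoreOf L
  have hPL : P ≤ L := fun b hb => hcL b ((mem_centerOf.1 hxP).2 b hb)
  rw [hasCharacteristic_iff]
  -- It suffices to show that `C_H(R)` is a `p`-group: being normal in `H`, it then lies in `O_p(H)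
  -- = R`.
  have hD : IsPGroup p (Subgroup.centralizer (R : Set G) ⊓ H : Subgroup G) := by
    refine isPGroup_of_forall_coprime fun y hy hyo => ?_
    have hyR : ∀ v ∈ R, Commute v y := Subgroup.mem_centralizer_iff.1 hy.1
    have hyP : ∀ b ∈ P, Commute y b := fun b hb => (hyR b (hPR hb)).symm
    have hyL : y ∈ L := hcL y (hyP x (centerOf_le P hxP))
    -- `C_G(P)` centralizes `x`, so it lies in `L` and normalizes `V`. Thus `C_V(P)` is a normal
    -- `p`-subgroup of `C_G(P)`, and `O_p(C_G(P)) ≤ R` because `C_G(P)` is normal in `H`.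
    have hCV : V ⊓ Subgroup.centralizer (P : Set G) ≤ R := by
      have hCH : Subgroup.centralizer (P : Set G) ≤ H := Subgroup.centralizer_le_normalizer _
      set C := Subgroup.centralizer (P : Set G) with hC
      have hHC : H ≤ Subgroup.normalizer (C : Set G) := by
        intro g hg
        rw [Subgroup.mem_normalizer_iff]
        have aux : ∀ g ∈ H, ∀ c ∈ C, g * c * g⁻¹ ∈ C := by
          intro g hg c hc
          rw [hC, Subgroup.mem_centralizer_iff] at hc ⊢
          intro b hb
          have h1 := hc _ ((Subgroup.mem_normalizer_iff''.1 hg b).1 hb)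
          have h2 := congrArg (fun z => g * z * g⁻¹) h1
          simpa [mul_assoc] using h2
        refine fun c => ⟨aux g hg c, fun hc => ?_⟩
        have := aux g⁻¹ (H.inv_mem hg) _ hc
        simpa [mul_assoc] using this
      have h1 : V ⊓ C ≤ pCoreOf p C := by
        refine le_pCoreOf inf_le_right (fun c hc => ?_) (hVp.to_le inf_le_left)
        have hcV : c ∈ Subgroup.normalizer (V : Set G) :=
          hLV (hcL c ((Subgroup.mem_centralizer_iff.1 hc x (centerOf_le P hxP)).symm))
        refine Subgroup.mem_normalizer_iff.2 fun v => and_congr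
          (Subgroup.mem_normalizer_iff.1 hcV v)
          (Subgroup.mem_normalizer_iff.1 (Subgroup.le_normalizer hc) v)
      exact h1.trans (le_pCoreOf ((pCoreOf_le C).trans hCH)
        (hHC.trans (normalizer_le_normalizer_pCoreOf C)) (isPGroup_pCoreOf C))
    have hyV : ∀ v ∈ V, Commute y v :=
      commute_of_commute_fixedPoints hP hyP hyo V hVp (hPL.trans hLV) (hLV hyL)
        fun v hv hbv => (hyR v (hCV ⟨hv, Subgroup.mem_centralizer_iff.2 hbv⟩)).symm
    -- Since `L` has characteristic `p`, the `p'`-element `y`, which centralizes `V = O_p(L)`, lies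
    -- in the `p`-group `V` and is therefore trivial.
    have hy2 : y ∈ V := hasCharacteristic_iff.1 hLchar y hyL fun v hv => (hyV v hv).symm
    obtain ⟨k, hk⟩ := hVp ⟨y, hy2⟩
    have hk : y ^ p ^ k = 1 := congrArg Subtype.val hk
    obtain ⟨j, -, hj⟩ := (Nat.dvd_prime_pow hp).1 (orderOf_dvd_of_pow_eq_one hk)
    rcases j with _ | j
    · rw [← orderOf_eq_one_iff, hj, pow_zero]
    · exact absurd (hj ▸ dvd_pow_self p j.succ_ne_zero) hyo
  intro y hy hyR
  refine le_pCoreOf inf_le_right (fun g hg => ?_) hD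
    ⟨Subgroup.mem_centralizer_iff.2 hyR, hy⟩
  have aux : ∀ g ∈ H, ∀ c ∈ Subgroup.centralizer (R : Set G),
      g * c * g⁻¹ ∈ Subgroup.centralizer (R : Set G) := by
    intro g hg c hc
    rw [Subgroup.mem_centralizer_iff] at hc ⊢
    intro b hb
    have h1 := hc _ ((Subgroup.mem_normalizer_iff''.1 (hHR hg) b).1 hb)
    have h2 := congrArg (fun z => g * z * g⁻¹) h1
    simpa [mul_assoc] using h2
  rw [Subgroup.mem_normalizer_iff]
  refine fun c => and_congr ⟨aux g hg c, fun hc => ?_⟩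
    (Subgroup.mem_normalizer_iff.1 (Subgroup.le_normalizer hg) c)
  have := aux g⁻¹ (H.inv_mem hg) _ hc
  simpa [mul_assoc] using this

end Distinguished

/-! ### Which subgroups arising in the zigzags are distinguished. -/

section Membership

variable {G : Type*} [Group G] {p : ℕ}

theorem ne_bot_of_distinguishedPart_ne_bot {P : Subgroup G} (h : distinguishedPart p P ≠ ⊥) :
    P ≠ ⊥ := by
  rintro rfl
  exact h (le_bot_iff.1 ((distinguishedPart_le_centerOf _).trans (centerOf_le _)))

theorem isElementaryAbelian_closure {s : Set G} (hc : ∀ x ∈ s, ∀ y ∈ s, x * y = y * x)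
    (hs : ∀ x ∈ s, x ^ p = 1) : IsElementaryAbelian p (Subgroup.closure s) := by
  have h1 : Subgroup.closure s ≤ Subgroup.centralizer (Subgroup.closure s : Set G) := by
    rw [Subgroup.centralizer_closure, Subgroup.closure_le]
    exact fun x hx => Subgroup.mem_centralizer_iff.2 fun y hy => hc y hy x hx
  have h2 : ∀ x ∈ Subgroup.closure s, ∀ y ∈ Subgroup.closure s, x * y = y * x :=
    fun x hx y hy => Subgroup.mem_centralizer_iff.1 (h1 hy) x hx
  refine ⟨h2, fun x hx => ?_⟩
  induction hx using Subgroup.closure_induction with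
  | mem x hx => exact hs x hx
  | one => exact one_pow p
  | mul a b ha hb iha ihb => rw [(show Commute a b from h2 a ha b hb).mul_pow, iha, ihb, one_mul]
  | inv a _ iha => rw [inv_pow, iha, inv_one]

theorem IsElementaryAbelian.sup {A B : Subgroup G} (hA : IsElementaryAbelian p A)
    (hB : IsElementaryAbelian p B) (h : ∀ x ∈ A, ∀ y ∈ B, x * y = y * x) :
    IsElementaryAbelian p (A ⊔ B) := by
  rw [Subgroup.sup_eq_closure]
  refine isElementaryAbelian_closure ?_ ?_
  · rintro x (hx | hx) y (hy | hy)
    · exact hA.1 x hx y hy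
    · exact h x hx y hy
    · exact (h y hy x hx).symm
    · exact hB.1 x hx y hy
  · rintro x (hx | hx)
    · exact hA.2 x hx
    · exact hB.2 x hx

theorem isElementaryAbelian_distinguishedPart (P : Subgroup G) :
    IsElementaryAbelian p (distinguishedPart p P) := by
  refine isElementaryAbelian_closure (fun x hx y hy => ?_) fun x hx => ?_
  · exact (mem_centerOf.1 (omegaOne_le _ hy.1)).2 x (centerOf_le _ (omegaOne_le _ hx.1))
  · rw [← hx.2.1]
    exact pow_orderOf_eq_one x

theorem distinguishedPart_ne_bot_of_isElementaryAbelian (hp : p.Prime) {P E : Subgroup G}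
    (hE : IsElementaryAbelian p E) (hP : distinguishedPart p P ≠ ⊥)
    (h : distinguishedPart p P ≤ E) : distinguishedPart p E ≠ ⊥ := by
  obtain ⟨x, hx, hc⟩ := (distinguishedPart_ne_bot_iff hp).1 hP
  have hxE := h (mem_distinguishedPart hx hc)
  exact (distinguishedPart_ne_bot_iff hp).2
    ⟨x, mem_centerOf.2 ⟨hxE, fun y hy => hE.1 y hy x hxE⟩, hc⟩

/-- A `p`-central element of `Z(Q)` centralizes `P`, so it survives in the center of `N_Q(P)`. -/
theorem distinguishedPart_inf_normalizer_ne_bot (hp : p.Prime) {P Q : Subgroup G} (hPQ : P ≤ Q)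
    (hQ : distinguishedPart p Q ≠ ⊥) :
    distinguishedPart p (Q ⊓ Subgroup.normalizer (P : Set G)) ≠ ⊥ := by
  obtain ⟨x, hx, hc⟩ := (distinguishedPart_ne_bot_iff hp).1 hQ
  obtain ⟨hxQ, hxc⟩ := mem_centerOf.1 hx
  refine (distinguishedPart_ne_bot_iff hp).2 ⟨x, mem_centerOf.2 ⟨⟨hxQ, ?_⟩, fun y hy => hxc y hy.1⟩,
    hc⟩
  exact Subgroup.centralizer_le_normalizer _
    (Subgroup.mem_centralizer_iff.2 fun y hy => hxc y (hPQ hy))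

theorem exists_mem_pCentralElements [Finite G] [Fact p.Prime] (hpG : p ∣ Nat.card G)
    (S : Sylow p G) : ∃ z ∈ centerOf (S : Subgroup G), z ∈ pCentralElements p G := by
  have hp : p.Prime := Fact.out
  have hne : (S : Subgroup G) ≠ ⊥ := S.ne_bot_of_dvd_card hpG
  have : Nontrivial (S : Subgroup G) := (Subgroup.nontrivial_iff_ne_bot _).2 hne
  have h1 := S.isPGroup'.center_nontrivial
  have h2 : p ∣ Nat.card (Subgroup.center (S : Subgroup G)) := by
    rcases (S.isPGroup'.to_subgroup (Subgroup.center (S : Subgroup G))).card_eq_or_dvd with h | h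
    · exact absurd h (Finite.one_lt_card).ne'
    · exact h
  obtain ⟨z, hz⟩ := exists_prime_orderOf_dvd_card' p h2
  have hzS : (z : G) ∈ centerOf (S : Subgroup G) := ⟨z, z.2, rfl⟩
  exact ⟨z, hzS, by rwa [Subgroup.orderOf_coe, Subgroup.orderOf_coe], S, hzS⟩

/-- If `N_G(P)` has characteristic `p`, then the `p`-subgroups of `N_G(P)` containing
`O_p(N_G(P))` are distinguished. -/
theorem distinguishedPart_ne_bot_of_pCoreOf_le [Finite G] [Fact p.Prime] (hpG : p ∣ Nat.card G)
    {P Q : Subgroup G} (hPc : HasCharacteristic p (Subgroup.normalizer (P : Set G)))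
    (hP : IsPGroup p P) (hQ : IsPGroup p Q)
    (hRQ : pCoreOf p (Subgroup.normalizer (P : Set G)) ≤ Q) :
    distinguishedPart p Q ≠ ⊥ := by
  obtain ⟨S, hS⟩ := hQ.exists_le_sylow
  obtain ⟨z, hz, hzc⟩ := exists_mem_pCentralElements hpG S
  have hcomm : ∀ y ∈ Q, Commute y z := fun y hy => (mem_centerOf.1 hz).2 y (hS hy)
  have hPR : P ≤ pCoreOf p (Subgroup.normalizer (P : Set G)) :=
    le_pCoreOf Subgroup.le_normalizer le_rfl hP
  have hzN : z ∈ Subgroup.normalizer (P : Set G) := Subgroup.centralizer_le_normalizer _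
    (Subgroup.mem_centralizer_iff.2 fun y hy => hcomm y (hRQ (hPR hy)))
  -- Characteristic `p` pulls the Sylow-central element `z` down into `O_p(N_G(P))`, hence into `Q`.
  have hzR := hasCharacteristic_iff.1 hPc z hzN fun v hv => hcomm v (hRQ hv)
  exact (distinguishedPart_ne_bot_iff Fact.out).2 ⟨z, mem_centerOf.2 ⟨hRQ hzR, hcomm⟩, hzc⟩

/-- Normalizers grow in the nilpotent group `Q`. -/
theorem lt_inf_normalizer [Finite G] [Fact p.Prime] {P Q : Subgroup G} (hQ : IsPGroup p Q)
    (h : P < Q) : P < Q ⊓ Subgroup.normalizer (P : Set G) := by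
  refine lt_of_le_of_ne (le_inf h.le Subgroup.le_normalizer) fun heq => ?_
  have := hQ.isNilpotent
  have h1 : P.subgroupOf Q < ⊤ := lt_top_iff_ne_top.2 fun h2 =>
    h.not_ge (Subgroup.subgroupOf_eq_top.1 h2)
  obtain ⟨q, hq, hqP⟩ := SetLike.exists_of_lt (Group.normalizerCondition_of_isNilpotent _ h1)
  rw [← Subgroup.subgroupOf_normalizer_eq h.le] at hq
  refine hqP ?_
  rw [Subgroup.mem_subgroupOf] at hq ⊢
  rw [heq]
  exact ⟨q.2, hq⟩

end Membership

/-! ### Collections of subgroups, and deletion by order. -/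

namespace PCollection

variable {G : Type*} [Group G] {p : ℕ}

theorem ext_carrier {C D : PCollection p G} (h : C.carrier = D.carrier) : C = D := by
  cases C; cases D; cases h; rfl

theorem coe_smul (C : PCollection p G) (g : G) (P : C.Elem) :
    (g • P).1 = P.1.map (MulAut.conj g).toMonoidHom := rfl

/-- The inclusion of a subcollection. -/
def inclusion {C D : PCollection p G} (h : D.carrier ⊆ C.carrier) : D.Elem ↪o C.Elem where
  toFun P := ⟨P.1, h P.2⟩
  inj' _ _ hPQ := Subtype.ext (congrArg (fun R : C.Elem => R.1) hPQ)
  map_rel_iff' := Iff.rfl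

theorem mem_range_inclusion {C D : PCollection p G} (h : D.carrier ⊆ C.carrier) {P : C.Elem} :
    P ∈ Set.range (inclusion h) ↔ P.1 ∈ D.carrier := by
  constructor
  · rintro ⟨Q, rfl⟩
    exact Q.2
  · exact fun hP => ⟨⟨P.1, hP⟩, rfl⟩

open Classical in
/-- An operation on subgroups, as an operation on a collection wherever its values belong to the
collection. -/
def lift (C : PCollection p G) (n : Subgroup G → Subgroup G → Subgroup G) (P Q : C.Elem) :
    C.Elem :=
  -- The fallback `Q` only makes the operation total; the deletion argument uses it only where
  -- membership holds.
  if h : n P.1 Q.1 ∈ C.carrier then ⟨n P.1 Q.1, h⟩ else Q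

theorem coe_lift (C : PCollection p G) {n : Subgroup G → Subgroup G → Subgroup G} {P Q : C.Elem}
    (h : n P.1 Q.1 ∈ C.carrier) : (C.lift n P Q).1 = n P.1 Q.1 := by
  rw [lift, dif_pos h]

theorem lift_smul (C : PCollection p G) {n : Subgroup G → Subgroup G → Subgroup G}
    (hn : ∀ (g : G) (P Q : Subgroup G), n (P.map (MulAut.conj g).toMonoidHom)
      (Q.map (MulAut.conj g).toMonoidHom) = (n P Q).map (MulAut.conj g).toMonoidHom) (g : G)
    {P Q : C.Elem} (h : n P.1 Q.1 ∈ C.carrier) :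
    C.lift n (g • P) (g • Q) = g • C.lift n P Q := by
  have h1 : n (g • P).1 (g • Q).1 = (n P.1 Q.1).map (MulAut.conj g).toMonoidHom := hn g P.1 Q.1
  have h2 : n (g • P).1 (g • Q).1 ∈ C.carrier := by
    rw [h1]
    exact C.conj_mem g _ h
  refine Subtype.ext ?_
  rw [coe_lift C h2, coe_smul C g (C.lift n P Q), coe_lift C h, h1]

theorem card_map_conj (g : G) (P : Subgroup G) :
    Nat.card (P.map (MulAut.conj g).toMonoidHom) = Nat.card P :=
  Subgroup.card_map_of_injective (MulAut.conj g).injective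

/-- The members of `C` which belong to `B` or have order at least `k`. -/
def orLarge (C B : PCollection p G) (k : ℕ) : PCollection p G where
  carrier := {P | P ∈ C.carrier ∧ (P ∈ B.carrier ∨ k ≤ Nat.card P)}
  isPGroup P h := C.isPGroup P h.1
  conj_mem g P h := ⟨C.conj_mem g P h.1, h.2.imp (B.conj_mem g P) fun h1 =>
    h1.trans (card_map_conj g P).ge⟩

theorem orLarge_succ_subset (C B : PCollection p G) (k : ℕ) :
    (C.orLarge B (k + 1)).carrier ⊆ (C.orLarge B k).carrier :=
  fun _ h => ⟨h.1, h.2.imp_right fun h1 => (Nat.le_succ k).trans h1⟩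

theorem mem_orLarge_diff {C B : PCollection p G} {k : ℕ} {P : Subgroup G}
    (h : P ∈ (C.orLarge B k).carrier \ (C.orLarge B (k + 1)).carrier) :
    P ∈ C.carrier ∧ P ∉ B.carrier ∧ Nat.card P = k := by
  have h1 : P ∉ B.carrier := fun hB => h.2 ⟨h.1.1, Or.inl hB⟩
  refine ⟨h.1.1, h1, le_antisymm ?_ (h.1.2.resolve_left h1)⟩
  by_contra! h2
  exact h.2 ⟨h.1.1, Or.inr h2⟩

variable [Finite G]

/-- The operation `r` is binary and evaluated on the diagonal only so that `lift` serves for all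
three operations. -/
theorem gHomotopyEquiv_of_upper_zigzag {C D : PCollection p G} (h : D.carrier ⊆ C.carrier)
    {n m r : Subgroup G → Subgroup G → Subgroup G}
    (hanti : ∀ P ∈ C.carrier \ D.carrier, ∀ Q ∈ C.carrier \ D.carrier, P ≤ Q → P = Q)
    (n_mem : ∀ P ∈ C.carrier \ D.carrier, ∀ Q ∈ C.carrier, P < Q → n P Q ∈ C.carrier)
    (m_mem : ∀ P ∈ C.carrier \ D.carrier, ∀ Q ∈ C.carrier, P < Q → m P Q ∈ C.carrier)
    (r_mem : ∀ P ∈ C.carrier \ D.carrier, r P P ∈ C.carrier)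
    (n_smul : ∀ (g : G) (P Q : Subgroup G), n (P.map (MulAut.conj g).toMonoidHom)
      (Q.map (MulAut.conj g).toMonoidHom) = (n P Q).map (MulAut.conj g).toMonoidHom)
    (m_smul : ∀ (g : G) (P Q : Subgroup G), m (P.map (MulAut.conj g).toMonoidHom)
      (Q.map (MulAut.conj g).toMonoidHom) = (m P Q).map (MulAut.conj g).toMonoidHom)
    (r_smul : ∀ (g : G) (P Q : Subgroup G), r (P.map (MulAut.conj g).toMonoidHom)
      (Q.map (MulAut.conj g).toMonoidHom) = (r P Q).map (MulAut.conj g).toMonoidHom)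
    (n_mono : ∀ P, Monotone (n P)) (m_mono : ∀ P, Monotone (m P))
    (lt_n : ∀ P ∈ C.carrier \ D.carrier, ∀ Q ∈ C.carrier, P < Q → P < n P Q)
    (n_le : ∀ P Q, n P Q ≤ Q) (n_le_m : ∀ P Q, n P Q ≤ m P Q)
    (lt_r : ∀ P ∈ C.carrier \ D.carrier, P < r P P) (r_le_m : ∀ P Q, r P P ≤ m P Q) :
    D.GHomotopyEquiv C := by
  have hx : ∀ P : C.Elem, P ∈ (Set.range (inclusion h))ᶜ → P.1 ∈ C.carrier \ D.carrier :=
    fun P hP => ⟨P.2, fun h1 => hP ((mem_range_inclusion h).2 h1)⟩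
  have hn : ∀ P : C.Elem, P ∈ (Set.range (inclusion h))ᶜ → ∀ Q : C.Elem, P < Q →
      (C.lift n P Q).1 = n P.1 Q.1 := fun P hP Q hQ => coe_lift C (n_mem _ (hx P hP) _ Q.2 hQ)
  have hm : ∀ P : C.Elem, P ∈ (Set.range (inclusion h))ᶜ → ∀ Q : C.Elem, P < Q →
      (C.lift m P Q).1 = m P.1 Q.1 := fun P hP Q hQ => coe_lift C (m_mem _ (hx P hP) _ Q.2 hQ)
  have hr : ∀ P : C.Elem, P ∈ (Set.range (inclusion h))ᶜ → (C.lift r P P).1 = r P.1 P.1 :=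
    fun P hP => coe_lift C (r_mem _ (hx P hP))
  refine Nerve.gHomotopyEquivalent_of_isUpperContraction (inclusion h) (fun _ _ => rfl)
    (n := C.lift n) (m := C.lift m) (r := fun P => C.lift r P P) ?_
    (fun g P hP Q hQ => lift_smul C n_smul g (n_mem _ (hx P hP) _ Q.2 hQ))
    (fun g P hP Q hQ => lift_smul C m_smul g (m_mem _ (hx P hP) _ Q.2 hQ))
    (fun g P hP => lift_smul C r_smul g (r_mem _ (hx P hP)))
  refine ⟨fun P hP Q hQ hPQ => Subtype.ext (hanti _ (hx P hP) _ (hx Q hQ) hPQ), ?_, ?_, ?_, ?_, ?_,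
    ?_, ?_⟩
  · intro P hP Q Q' hQ hQ'
    rw [← Subtype.coe_le_coe, hn P hP Q hQ, hn P hP Q' (hQ.trans_le hQ')]
    exact n_mono _ hQ'
  · intro P hP Q Q' hQ hQ'
    rw [← Subtype.coe_le_coe, hm P hP Q hQ, hm P hP Q' (hQ.trans_le hQ')]
    exact m_mono _ hQ'
  · intro P hP Q hQ
    rw [← Subtype.coe_lt_coe, hn P hP Q hQ]
    exact lt_n _ (hx P hP) _ Q.2 hQ
  · intro P hP Q hQ
    rw [← Subtype.coe_le_coe, hn P hP Q hQ]
    exact n_le _ _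
  · intro P hP Q hQ
    rw [← Subtype.coe_le_coe, hn P hP Q hQ, hm P hP Q hQ]
    exact n_le_m _ _
  · intro P hP
    rw [← Subtype.coe_lt_coe, hr P hP]
    exact lt_r _ (hx P hP)
  · intro P hP Q hQ
    rw [← Subtype.coe_le_coe, hr P hP, hm P hP Q hQ]
    exact r_le_m _ _

theorem gHomotopyEquiv_of_lower_cone {C D : PCollection p G} (h : D.carrier ⊆ C.carrier)
    {m r : Subgroup G → Subgroup G → Subgroup G}
    (hanti : ∀ P ∈ C.carrier \ D.carrier, ∀ Q ∈ C.carrier \ D.carrier, P ≤ Q → P = Q)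
    (m_mem : ∀ P ∈ C.carrier \ D.carrier, ∀ Q ∈ C.carrier, Q < P → m P Q ∈ C.carrier)
    (r_mem : ∀ P ∈ C.carrier \ D.carrier, r P P ∈ C.carrier)
    (m_smul : ∀ (g : G) (P Q : Subgroup G), m (P.map (MulAut.conj g).toMonoidHom)
      (Q.map (MulAut.conj g).toMonoidHom) = (m P Q).map (MulAut.conj g).toMonoidHom)
    (r_smul : ∀ (g : G) (P Q : Subgroup G), r (P.map (MulAut.conj g).toMonoidHom)
      (Q.map (MulAut.conj g).toMonoidHom) = (r P Q).map (MulAut.conj g).toMonoidHom)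
    (m_mono : ∀ P, Monotone (m P)) (le_m : ∀ P Q, Q ≤ m P Q)
    (m_lt : ∀ P ∈ C.carrier \ D.carrier, ∀ Q ∈ C.carrier, Q < P → m P Q < P)
    (r_lt : ∀ P ∈ C.carrier \ D.carrier, r P P < P) (r_le_m : ∀ P Q, r P P ≤ m P Q) :
    D.GHomotopyEquiv C := by
  have hx : ∀ P : C.Elem, P ∈ (Set.range (inclusion h))ᶜ → P.1 ∈ C.carrier \ D.carrier :=
    fun P hP => ⟨P.2, fun h1 => hP ((mem_range_inclusion h).2 h1)⟩
  have hm : ∀ P : C.Elem, P ∈ (Set.range (inclusion h))ᶜ → ∀ Q : C.Elem, Q < P →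
      (C.lift m P Q).1 = m P.1 Q.1 := fun P hP Q hQ => coe_lift C (m_mem _ (hx P hP) _ Q.2 hQ)
  have hr : ∀ P : C.Elem, P ∈ (Set.range (inclusion h))ᶜ → (C.lift r P P).1 = r P.1 P.1 :=
    fun P hP => coe_lift C (r_mem _ (hx P hP))
  refine Nerve.gHomotopyEquivalent_of_lower_cone (inclusion h) (fun _ _ => rfl)
    (m := C.lift m) (r := fun P => C.lift r P P)
    (fun P hP Q hQ hPQ => Subtype.ext (hanti _ (hx P hP) _ (hx Q hQ) hPQ)) ?_ ?_ ?_ ?_ ?_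
    (fun g P hP Q hQ => lift_smul C m_smul g (m_mem _ (hx P hP) _ Q.2 hQ))
    (fun g P hP => lift_smul C r_smul g (r_mem _ (hx P hP)))
  · intro P hP Q Q' hQ hQ'
    rw [← Subtype.coe_le_coe, hm P hP Q (hQ.trans_lt hQ'), hm P hP Q' hQ']
    exact m_mono _ hQ
  · intro P hP Q hQ
    rw [← Subtype.coe_lt_coe, hm P hP Q hQ]
    exact m_lt _ (hx P hP) _ Q.2 hQ
  · intro P hP Q hQ
    rw [← Subtype.coe_le_coe, hm P hP Q hQ]
    exact le_m _ _
  · intro P hP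
    rw [← Subtype.coe_lt_coe, hr P hP]
    exact r_lt _ (hx P hP)
  · intro P hP Q hQ
    rw [← Subtype.coe_le_coe, hr P hP, hm P hP Q hQ]
    exact r_le_m _ _

theorem card_lt_card_of_lt {P Q : Subgroup G} (h : P < Q) : Nat.card P < Nat.card Q :=
  Set.ncard_lt_ncard (SetLike.coe_ssubset_coe.2 h)

theorem orLarge_diff_antichain {C B : PCollection p G} {k : ℕ} :
    ∀ P ∈ (C.orLarge B k).carrier \ (C.orLarge B (k + 1)).carrier,
    ∀ Q ∈ (C.orLarge B k).carrier \ (C.orLarge B (k + 1)).carrier, P ≤ Q → P = Q := by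
  intro P hP Q hQ h
  by_contra hne
  have := card_lt_card_of_lt (lt_of_le_of_ne h hne)
  rw [(mem_orLarge_diff hP).2.2, (mem_orLarge_diff hQ).2.2] at this
  exact lt_irrefl _ this

/-- The filtration starts at `C` for `k = 0` and reaches `B` at `k = Nat.card G + 1`, where no
subgroup is large enough for the second alternative. -/
theorem gHomotopyEquiv_of_orLarge {C B : PCollection p G} (hBC : B.carrier ⊆ C.carrier)
    (h : ∀ k, (C.orLarge B (k + 1)).GHomotopyEquiv (C.orLarge B k)) : B.GHomotopyEquiv C := by
  have h0 : C.orLarge B 0 = C :=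
    ext_carrier (Set.ext fun P => ⟨fun h => h.1, fun h => ⟨h, Or.inr (Nat.zero_le _)⟩⟩)
  have h1 : C.orLarge B (Nat.card G + 1) = B := by
    refine ext_carrier (Set.ext fun P => ⟨fun h => h.2.resolve_right fun h2 => ?_,
      fun h => ⟨hBC h, Or.inl h⟩⟩)
    exact absurd (Subgroup.card_le_card_group P) (by omega)
  have h2 : ∀ k, (C.orLarge B k).GHomotopyEquiv C := by
    intro k
    induction k with
    | zero => rw [h0]; exact GHomotopyEquivalent.refl
    | succ k ih => exact GHomotopyEquivalent.trans (h k) ih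
  exact h1 ▸ h2 (Nat.card G + 1)

/-! ### The two comparisons with the Brown collection. -/

theorem quillen_gHomotopyEquiv_brown (hp : p.Prime) :
    (quillen p G).distinguished.GHomotopyEquiv (brown p G).distinguished := by
  refine gHomotopyEquiv_of_orLarge
    (fun P h => ⟨⟨h.1.1, (quillen p G).isPGroup P h.1⟩, h.2⟩) fun k => ?_
  have hmem : ∀ {E : Subgroup G}, IsElementaryAbelian p E → distinguishedPart p E ≠ ⊥ →
      E ∈ ((brown p G).distinguished.orLarge (quillen p G).distinguished k).carrier :=
    fun {E} hE hd => by
      have h1 := ne_bot_of_distinguishedPart_ne_bot hd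
      exact ⟨⟨⟨h1, (quillen p G).isPGroup E ⟨h1, hE⟩⟩, hd⟩, Or.inl ⟨⟨h1, hE⟩, hd⟩⟩
  have hnel : ∀ P ∈ ((brown p G).distinguished.orLarge (quillen p G).distinguished k).carrier \
      ((brown p G).distinguished.orLarge (quillen p G).distinguished (k + 1)).carrier,
      ¬ IsElementaryAbelian p P := fun P hP hE => by
    obtain ⟨h1, h2, -⟩ := mem_orLarge_diff hP
    exact h2 ⟨⟨h1.1.1, hE⟩, h1.2⟩
  have hsup : ∀ P ∈ ((brown p G).distinguished.orLarge (quillen p G).distinguished k).carrier \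
      ((brown p G).distinguished.orLarge (quillen p G).distinguished (k + 1)).carrier,
      ∀ Q ∈ ((brown p G).distinguished.orLarge (quillen p G).distinguished k).carrier, Q < P →
      IsElementaryAbelian p (Q ⊔ distinguishedPart p P) := by
    intro P hP Q hQ hQP
    -- Since `Q` has order less than `k`, it can only have survived by being elementary abelian.
    have h1 : Q ∈ (quillen p G).distinguished.carrier := by
      refine hQ.2.resolve_right fun h2 => ?_
      have h3 := card_lt_card_of_lt hQP
      rw [(mem_orLarge_diff hP).2.2] at h3
      exact absurd h3 (not_lt.2 h2)
    refine h1.1.2.sup (isElementaryAbelian_distinguishedPart P) fun x hx y hy => ?_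
    exact (mem_centerOf.1 (distinguishedPart_le_centerOf P hy)).2 x (hQP.le hx)
  have hle : ∀ P : Subgroup G, distinguishedPart p P ≤ P := fun P =>
    (distinguishedPart_le_centerOf P).trans (centerOf_le P)
  refine gHomotopyEquiv_of_lower_cone (orLarge_succ_subset _ _ k)
    (m := fun P Q => Q ⊔ distinguishedPart p P) (r := fun P _ => distinguishedPart p P)
    orLarge_diff_antichain ?_ ?_ ?_ ?_ ?_ ?_ ?_ ?_ ?_
  · intro P hP Q hQ hQP
    have h := hsup P hP Q hQ hQP
    exact hmem h (distinguishedPart_ne_bot_of_isElementaryAbelian hp h hP.1.1.2 le_sup_right)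
  · intro P hP
    have h := isElementaryAbelian_distinguishedPart (p := p) P
    exact hmem h (distinguishedPart_ne_bot_of_isElementaryAbelian hp h hP.1.1.2 le_rfl)
  · intro g P Q
    rw [Subgroup.map_sup, map_distinguishedPart]
  · intro g P _
    exact (map_distinguishedPart g P).symm
  · exact fun P Q Q' h => sup_le_sup_right h _
  · exact fun P Q => le_sup_left
  · intro P hP Q hQ hQP
    refine lt_of_le_of_ne (sup_le hQP.le (hle P)) fun h => hnel P hP ?_
    have h1 := hsup P hP Q hQ hQP
    rwa [h] at h1
  · intro P hP
    refine lt_of_le_of_ne (hle P) fun h => hnel P hP ?_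
    have h1 := isElementaryAbelian_distinguishedPart (p := p) P
    rwa [h] at h1
  · exact fun P Q => le_sup_right

theorem bouc_gHomotopyEquiv_brown (hp : p.Prime) (hpG : p ∣ Nat.card G)
    (hG : HasParabolicCharacteristic p G) :
    (bouc p G).distinguished.GHomotopyEquiv (brown p G).distinguished := by
  have : Fact p.Prime := ⟨hp⟩
  refine gHomotopyEquiv_of_orLarge
    (fun P h => ⟨⟨h.1.1, h.1.2.1⟩, h.2⟩) fun k => ?_
  set C := (brown p G).distinguished.orLarge (bouc p G).distinguished k with hC
  set C' := (brown p G).distinguished.orLarge (bouc p G).distinguished (k + 1) with hC'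
  -- Deleting small orders first means that every distinguished `p`-subgroup above `P` is still
  -- present.
  have hmem : ∀ P ∈ C.carrier \ C'.carrier, ∀ Q : Subgroup G, P ≤ Q → IsPGroup p Q →
      distinguishedPart p Q ≠ ⊥ → Q ∈ C.carrier := by
    intro P hP Q hPQ hQ hd
    refine ⟨⟨⟨ne_bot_of_distinguishedPart_ne_bot hd, hQ⟩, hd⟩, Or.inr ?_⟩
    rw [← (mem_orLarge_diff hP).2.2]
    exact Subgroup.card_le_of_le hPQ
  have hPR : ∀ P ∈ C.carrier \ C'.carrier,
      P < pCoreOf p (Subgroup.normalizer (P : Set G)) := by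
    intro P hP
    obtain ⟨h1, h2, -⟩ := mem_orLarge_diff hP
    refine lt_of_le_of_ne (le_pCoreOf Subgroup.le_normalizer le_rfl h1.1.2) fun h => h2 ?_
    exact ⟨⟨h1.1.1, h1.1.2, h⟩, h1.2⟩
  have hchar : ∀ P ∈ C.carrier \ C'.carrier,
      HasCharacteristic p (Subgroup.normalizer (P : Set G)) := fun P hP =>
    hG.hasCharacteristic_normalizer hP.1.1.1.2 hP.1.1.2
  refine gHomotopyEquiv_of_upper_zigzag (orLarge_succ_subset _ _ k)
    (n := fun P Q => Q ⊓ Subgroup.normalizer (P : Set G))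
    (m := fun P Q => pCoreOf p (Subgroup.normalizer (P : Set G)) ⊔
      (Q ⊓ Subgroup.normalizer (P : Set G)))
    (r := fun P _ => pCoreOf p (Subgroup.normalizer (P : Set G)))
    orLarge_diff_antichain ?_ ?_ ?_ ?_ ?_ ?_ ?_ ?_ ?_ ?_ ?_ ?_ ?_
  · intro P hP Q hQ hPQ
    exact hmem P hP _ (lt_inf_normalizer hQ.1.1.2 hPQ).le (hQ.1.1.2.to_le inf_le_left)
      (distinguishedPart_inf_normalizer_ne_bot hp hPQ.le hQ.1.2)
  -- `N_Q(P)` normalizes `O_p(N_G(P))`, so the join is a `p`-group; characteristic `p` makes it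
  -- distinguished.
  · intro P hP Q hQ hPQ
    have h1 : IsPGroup p (pCoreOf p (Subgroup.normalizer (P : Set G)) ⊔
        (Q ⊓ Subgroup.normalizer (P : Set G)) : Subgroup G) :=
      (isPGroup_pCoreOf _).to_sup_of_normal_left' (hQ.1.1.2.to_le inf_le_left)
        ((inf_le_right.trans Subgroup.le_normalizer).trans (normalizer_le_normalizer_pCoreOf _))
    exact hmem P hP _ ((hPR P hP).le.trans le_sup_left) h1
      (distinguishedPart_ne_bot_of_pCoreOf_le hpG (hchar P hP) hP.1.1.1.2 h1 le_sup_left)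
  · intro P hP
    exact hmem P hP _ (hPR P hP).le (isPGroup_pCoreOf _)
      (distinguishedPart_ne_bot_of_pCoreOf_le hpG (hchar P hP) hP.1.1.1.2 (isPGroup_pCoreOf _)
        le_rfl)
  · intro g P Q
    rw [← Subgroup.map_equiv_normalizer_eq]
    exact (Subgroup.map_inf_eq _ _ _ (MulAut.conj g).injective).symm
  · intro g P Q
    rw [← Subgroup.map_equiv_normalizer_eq, Subgroup.map_sup, map_pCoreOf]
    congr 1
    exact (Subgroup.map_inf_eq _ _ _ (MulAut.conj g).injective).symm
  · intro g P _
    rw [← Subgroup.map_equiv_normalizer_eq, map_pCoreOf]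
  · exact fun P Q Q' h => inf_le_inf_right _ h
  · exact fun P Q Q' h => sup_le_sup_left (inf_le_inf_right _ h) _
  · exact fun P _ Q hQ hPQ => lt_inf_normalizer hQ.1.1.2 hPQ
  · exact fun P Q => inf_le_left
  · exact fun P Q => le_sup_right
  · exact hPR
  · exact fun P Q => le_sup_left

end PCollection

end

theorem proposition3p7 (G : Type*) [Group G] [Finite G] (p : ℕ) (hp : p.Prime)
    (hpG : p ∣ Nat.card G) (hG : HasParabolicCharacteristic p G) :
    (PCollection.bouc p G).distinguished.GHomotopyEquiv (PCollection.quillen p G).distinguished ∧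
    (PCollection.quillen p G).distinguished.GHomotopyEquiv (PCollection.brown p G).distinguished ∧
    (PCollection.bouc p G).distinguished.GHomotopyEquiv (PCollection.brown p G).distinguished :=
  have hA := PCollection.quillen_gHomotopyEquiv_brown (G := G) hp
  have hB := PCollection.bouc_gHomotopyEquiv_brown hp hpG hG
  ⟨GHomotopyEquivalent.trans hB hA.symm, hA, hB⟩
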